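/- Let $A=(a_{ij})_{i,j\in I}$ be a generalized Cartan matrix with finite index set $I$ ($a_{ii}=2$; $a_{ij}\in\mathbb Z_{\le 0}$ for $i\ne j$; $a_{ij}=0\Rightarrow a_{ji}=0$). Let $V$ be a finite-dimensional real vector space with linearly independent $\alpha_i\in V$ and linearly independent $h_i\in V^*$ ($i\in I$) such that $\alpha_j(h_i)=a_{ij}$, where $\lambda(h_i)$ denotes the value of $h_i$ at $\lambda\in V$. Let $\mathcal W\subseteq GL(V)$ be the Weyl group, generated by the reflections $\sigma_i\lambda=\lambda-\lambda(h_i)\alpha_i$, and $\mathcal W_J=\langle\sigma_i\mid i\in J\rangle$ for $J\subseteq I$. Let $\overline C=\{\lambda\mid\lambda(h_i)\ge0\ \forall i\}$, let $X=\mathcal W\,\overline C$ be the Tits cone, and let $F_J=\{\lambda\mid\lambda(h_i)=0\ (i\in J),\ \lambda(h_i)>0\ (i\notin J)\}$ and $\overline F_J=\{\lambda\mid\lambda(h_i)=0\ (i\in J),\ \lambda(h_i)\ge0\ (i\notin J)\}$. The sets $\tau F_J$ ($\tau\in\mathcal W$, $J\subseteq I$) are the open facets of $X$. For $\Theta\subseteq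 I$ let $\Theta^\infty$ be the union of those connected components $K$ of $\Theta$ (in the Dynkin diagram of $A_\Theta$) for which the submatrix $A_K$ is not of finite type; $\Theta$ is called special if $\Theta=\Theta^\infty$. Put $\Theta^\perp=\{i\in I\mid a_{ij}=0\ \forall j\in\Theta\}$ and $R(\Theta)=\mathcal W_{\Theta^\perp}\overline F_\Theta$. The face monoid $\widehat{\mathcal W}$ consists of the classes $\sigma\lceil R\rceil$ of pairs $(\sigma,R)$, $\sigma\in\mathcal W$, $R$ a face of the convex cone $X$, where $(\sigma,R)\sim(\sigma',R')$ iff $R=R'$ and $\sigma^{-1}\sigma'$ fixes $R$ pointwise, with multiplication $\sigma\lceil R\rceil\cdot\tau\lceil S\rceil=\sigma\tau\lceil\tau^{-1}R\cap S\rceil$; write $\sigma=\sigma\lceil X\rceil$ and $\lceil R\rceil=1\lceil R\rceil$. It acts on $X$ by $(\sigma\lceil R\rceil)\lambda=\sigma\lambda$ if $\lambda\in R$, and $=0$ if $\lambda\in X\setminus R$. For $J\subseteq I$ put $\widehat{\mathcal W}_J=\{w\lceil R\rceil\mid w\in\mathcal W_J,\ R\text{ a face of }X,\ R\supseteq R(J^\infty)\}$.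 The Coxeter complex is $\mathcal C=\{\sigma\mathcal W_J\mid\sigma\in\mathcal W,\ J\subseteq I\}$, ordered by reverse inclusion; put $\mathcal W_J\!\downarrow=\{v\in\mathcal C\mid v\le\mathcal W_J\}$. **Proposition (Bad action).** $X$ is a convex cone, $R(\Theta)$ is a face of $X$ for every special $\Theta$, and every element of $\widehat{\mathcal W}$ has the form $\sigma_1\lceil R(\Theta)\rceil\sigma_2$ with $\sigma_1,\sigma_2\in\mathcal W$ and $\Theta$ special. There is an action $\Box$ of the monoid $\widehat{\mathcal W}$ on the set $\mathcal C$ given by $$\sigma_1\lceil R(\Theta)\rceil\sigma_2\ \Box\ \tau\mathcal W_J=\begin{cases}\sigma_1\sigma_2\tau\mathcal W_J&\text{if }\sigma_2\tau\mathcal W_J\in\mathcal W_{\Theta^\perp}(\mathcal W_\Theta\!\downarrow),\\ \mathcal W_I&\text{otherwise,}\end{cases}$$ for all $\sigma_1,\sigma_2,\tau\in\mathcal W$, $J\subseteq I$ and special $\Theta\subseteq I$. It is induced by the action of $\widehat{\mathcal W}$ on $X$: under the correspondence $\tau\mathcal W_J\leftrightarrow\tau F_J$, every $\hat\sigma\in\widehat{\mathcal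 W}$ maps the open facet of $c\in\mathcal C$ into the open facet of $\hat\sigma\,\Box\,c$. The action $\Box$ is faithful, and for every $J\subseteq I$ the stabilizer of $\mathcal W_J\in\mathcal C$ is $\widehat{\mathcal W}_J$. The action is in general not order preserving: it does not preserve the order on $\mathcal C$ whenever there is a special set $\Theta$ with $\emptyset\ne\Theta\ne I$, and there are $A$ (even symmetric) and $V$ (with $\dim V=2|I|-\operatorname{rank}A$) for which it does not preserve the order. -/

import Mathlib

/-- Generalized Cartan matrices. -/
structure IsGCM {ι : Type*} (A : Matrix ι ι ℤ) : Prop where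
  diag : ∀ i, A i i = 2
  nonpos : ∀ i j, i ≠ j → A i j ≤ 0
  zero_symm : ∀ i j, A i j = 0 → A j i = 0

/-- A square matrix `B` is of finite type: `det B ≠ 0`, there is `u > 0` with `B u > 0`, and
`B v ≥ 0` implies `v > 0` or `v = 0` (all inequalities coordinatewise, `u`, `v` real). -/
def IsFiniteType {κ : Type*} [Fintype κ] [DecidableEq κ] (B : Matrix κ κ ℤ) : Prop :=
  B.det ≠ 0 ∧
  (∃ u : κ → ℝ, (∀ i, 0 < u i) ∧ ∀ i, 0 < (B.map (Int.cast : ℤ → ℝ)).mulVec u i) ∧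
  ∀ v : κ → ℝ, (∀ i, 0 ≤ (B.map (Int.cast : ℤ → ℝ)).mulVec v i) → (∀ i, 0 < v i) ∨ v = 0

section Subsets

variable {ι : Type*} [Fintype ι] (A : Matrix ι ι ℤ)

/-- For `i ∈ Θ`: the connected component of `i` in the Dynkin diagram of the principal
submatrix `A_Θ`. -/
def dynkinComponent (Θ : Set ι) (i : ι) : Set ι :=
  {j | Relation.ReflTransGen (fun a b => a ∈ Θ ∧ b ∈ Θ ∧ A a b ≠ 0) i j}

open Classical in
/-- The principal submatrix `A_K` is of finite type. -/
def IsFiniteTypeOn (K : Set ι) : Prop :=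
  IsFiniteType (A.submatrix (Subtype.val : K → ι) (Subtype.val : K → ι))

/-- `Θ^∞`: the union of the components of `Θ` that are not of finite type. -/
def infinitePart (Θ : Set ι) : Set ι :=
  {i | i ∈ Θ ∧ ¬ IsFiniteTypeOn A (dynkinComponent A Θ i)}

/-- A subset `Θ` is special if `Θ = Θ^∞`. -/
def IsSpecial (Θ : Set ι) : Prop := Θ = infinitePart A Θ

/-- `J^⊥ = {i ∈ I | a_ij = 0 for all j ∈ J}`. -/
def orthSet (J : Set ι) : Set ι := {i | ∀ j ∈ J, A i j = 0}

end Subsets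

/-- A free realization, over the reals, of the generalized Cartan matrix `A`. The space `V` plays
the role of `h_ℝ^*`; `root i` is `α_i`, and the linear form `coroot i` is evaluation at `h_i`. -/
structure FreeRealization {ι : Type*} (A : Matrix ι ι ℤ) (V : Type*)
    [AddCommGroup V] [Module ℝ V] where
  isGCM : IsGCM A
  root : ι → V
  coroot : ι → Module.Dual ℝ V
  linearIndependent_root : LinearIndependent ℝ root
  linearIndependent_coroot : LinearIndependent ℝ coroot
  coroot_root : ∀ i j, coroot i (root j) = (A i j : ℝ)

noncomputable section

namespace FreeRealization

variable {ι : Type*} {A : Matrix ι ι ℤ} {V : Type*} [AddCommGroup V] [Module ℝ V]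
  (D : FreeRealization A V)

/-! ### The Weyl group and its parabolic subgroups -/

theorem coroot_root_self (i : ι) : D.coroot i (D.root i) = 2 := by
  rw [D.coroot_root, D.isGCM.diag]; norm_num

/-- The simple reflection `λ ↦ λ - λ(h_i) α_i`. -/
def simpleReflection (i : ι) : V ≃ₗ[ℝ] V := Module.reflection (D.coroot_root_self i)

/-- The Weyl group, as a group of linear automorphisms of `V`. -/
def weylGroup : Subgroup (V ≃ₗ[ℝ] V) := Subgroup.closure (Set.range D.simpleReflection)

/-- The simple reflection as an element of the Weyl group. -/
def simple (i : ι) : D.weylGroup :=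
  ⟨D.simpleReflection i, Subgroup.subset_closure (Set.mem_range_self i)⟩

/-- The standard parabolic subgroup `W_J`. -/
def parabolic (J : Set ι) : Subgroup D.weylGroup := Subgroup.closure (D.simple '' J)

/-! ### Facets, the Tits cone and its faces -/

/-- The closed fundamental chamber. -/
def closedChamber : Set V := {v | ∀ i, 0 ≤ D.coroot i v}

/-- The open facet `F_J` of the closed fundamental chamber. -/
def openFacet (J : Set ι) : Set V :=
  {v | (∀ i ∈ J, D.coroot i v = 0) ∧ ∀ i, i ∉ J → 0 < D.coroot i v}

/-- The closed facet of type `J` of the closed fundamental chamber. -/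
def closedFacet (J : Set ι) : Set V :=
  {v | (∀ i ∈ J, D.coroot i v = 0) ∧ ∀ i, i ∉ J → 0 ≤ D.coroot i v}

/-- The Tits cone: the union of the Weyl group translates of the closed fundamental chamber. -/
def titsCone : Set V := {v | ∃ w : D.weylGroup, ∃ u ∈ D.closedChamber, v = w • u}

/-- The convex cone spanned by the Tits cone. The Tits cone is itself a convex cone, so that both
have the same points. -/
def titsConvexCone : PointedCone ℝ V := PointedCone.hull ℝ D.titsCone

theorem smul_mem_titsCone (w : D.weylGroup) {v : V} (hv : v ∈ D.titsCone) :
    w • v ∈ D.titsCone := by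
  obtain ⟨w', u, hu, rfl⟩ := hv
  exact ⟨w * w', u, hu, (mul_smul w w' u).symm⟩

theorem zero_mem_titsCone : (0 : V) ∈ D.titsCone :=
  ⟨1, 0, fun i => by simp, by simp⟩

theorem smul_mem_titsConvexCone (w : D.weylGroup) {v : V} (hv : v ∈ D.titsConvexCone) :
    w • v ∈ D.titsConvexCone := by
  have h : D.titsConvexCone ≤ D.titsConvexCone.comap ((w : V ≃ₗ[ℝ] V) : V →ₗ[ℝ] V) :=
    Submodule.span_le.2 fun x hx =>
      PointedCone.mem_comap.2 (PointedCone.subset_hull (D.smul_mem_titsCone w hx))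
  exact PointedCone.mem_comap.1 (h hv)

/-- The faces of the Tits cone, in the sense of convex geometry. -/
@[ext]
structure Face where
  cone : PointedCone ℝ V
  isFace : cone.IsFaceOf D.titsConvexCone

variable {D} in
/-- The set of points of a face. -/
def Face.carrier (R : D.Face) : Set V := (R.cone : Set V)

variable {D} in
/-- The image `wR` of a face `R` under an element `w` of the Weyl group. -/
def Face.translate (w : D.weylGroup) (R : D.Face) : D.Face where
  cone := R.cone.map ((w : V ≃ₗ[ℝ] V) : V →ₗ[ℝ] V)
  isFace := by
    have h : D.titsConvexCone.map ((w : V ≃ₗ[ℝ] V) : V →ₗ[ℝ] V) = D.titsConvexCone := by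
      apply le_antisymm
      · intro x hx
        obtain ⟨y, hy, rfl⟩ := PointedCone.mem_map.1 hx
        exact D.smul_mem_titsConvexCone w hy
      · intro x hx
        exact PointedCone.mem_map.2
          ⟨w⁻¹ • x, D.smul_mem_titsConvexCone w⁻¹ hx, smul_inv_smul w x⟩
    have := R.isFace.map_equiv (w : V ≃ₗ[ℝ] V)
    rwa [h] at this

variable {D} in
/-- The intersection of two faces. -/
def Face.inter (R S : D.Face) : D.Face := ⟨R.cone ⊓ S.cone, R.isFace.inf_left S.isFace⟩

/-- The whole Tits cone as a face. -/
def Face.whole : D.Face := ⟨D.titsConvexCone, .rfl⟩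

variable {D} in
theorem Face.ext_carrier {R S : D.Face} (h : ∀ v, v ∈ R.carrier ↔ v ∈ S.carrier) : R = S :=
  Face.ext (SetLike.ext h)

variable {D} in
theorem Face.mem_translate {w : D.weylGroup} {R : D.Face} {v : V} :
    v ∈ (R.translate w).carrier ↔ w⁻¹ • v ∈ R.carrier := by
  constructor
  · intro h
    obtain ⟨y, hy, rfl⟩ := PointedCone.mem_map.1 h
    have : w⁻¹ • w • y ∈ R.carrier := by rw [inv_smul_smul]; exact hy
    exact this
  · intro h
    exact PointedCone.mem_map.2 ⟨w⁻¹ • v, h, smul_inv_smul w v⟩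

variable {D} in
theorem Face.mem_inter {R S : D.Face} {v : V} :
    v ∈ (R.inter S).carrier ↔ v ∈ R.carrier ∧ v ∈ S.carrier := Iff.rfl

theorem Face.mem_whole_of_mem_titsCone {v : V} (hv : v ∈ D.titsCone) :
    v ∈ (Face.whole D).carrier := PointedCone.subset_hull hv

variable {D} in
theorem Face.mem_whole_of_mem {R : D.Face} {v : V} (hv : v ∈ R.carrier) :
    v ∈ (Face.whole D).carrier := R.isFace.le hv

/-- The set `R(Θ) = W_{Θ^⊥} F̄_Θ`; for special `Θ` it is a face of the Tits cone. -/
def specialFace (Θ : Set ι) : Set V :=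
  {v | ∃ w ∈ D.parabolic (orthSet A Θ), ∃ u ∈ D.closedFacet Θ, v = w • u}

/-! ### The face monoid -/

/-- The semidirect product of the Weyl group and the monoid of faces under intersection. -/
@[ext]
structure FaceSemidirect where
  w : D.weylGroup
  face : D.Face

instance : Monoid D.FaceSemidirect where
  mul x y := ⟨x.w * y.w, (x.face.translate y.w⁻¹).inter y.face⟩
  one := ⟨1, Face.whole D⟩
  mul_assoc x y z := by
    refine FaceSemidirect.ext (mul_assoc x.w y.w z.w) (Face.ext_carrier fun v => ?_)
    change v ∈ (((x.face.translate y.w⁻¹).inter y.face).translate z.w⁻¹ |>.inter z.face).carrier ↔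
      v ∈ ((x.face.translate (y.w * z.w)⁻¹).inter
        ((y.face.translate z.w⁻¹).inter z.face)).carrier
    simp only [Face.mem_inter, Face.mem_translate, inv_inv, mul_smul, and_assoc]
  one_mul x := by
    refine FaceSemidirect.ext (one_mul x.w) (Face.ext_carrier fun v => ?_)
    change v ∈ (((Face.whole D).translate x.w⁻¹).inter x.face).carrier ↔ v ∈ x.face.carrier
    rw [Face.mem_inter, Face.mem_translate, inv_inv]
    exact ⟨fun h => h.2, fun h => ⟨D.smul_mem_titsConvexCone x.w (Face.mem_whole_of_mem h), h⟩⟩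
  mul_one x := by
    refine FaceSemidirect.ext (mul_one x.w) (Face.ext_carrier fun v => ?_)
    change v ∈ ((x.face.translate (1 : D.weylGroup)⁻¹).inter (Face.whole D)).carrier ↔
      v ∈ x.face.carrier
    rw [Face.mem_inter, Face.mem_translate, inv_inv, one_smul]
    exact ⟨fun h => h.1, fun h => ⟨h, Face.mem_whole_of_mem h⟩⟩

theorem FaceSemidirect.mul_w (x y : D.FaceSemidirect) : (x * y).w = x.w * y.w := rfl

theorem FaceSemidirect.mul_face (x y : D.FaceSemidirect) :
    (x * y).face = (x.face.translate y.w⁻¹).inter y.face := rfl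

/-- The congruence `(σ, R) ∼ (σ', R')` iff `R = R'` and `σ⁻¹σ'` fixes `R` pointwise. -/
def faceCon : Con D.FaceSemidirect where
  r x y := x.face = y.face ∧ x.w⁻¹ * y.w ∈ fixingSubgroup D.weylGroup x.face.carrier
  iseqv :=
    { refl := fun x => ⟨rfl, by rw [inv_mul_cancel]; exact one_mem _⟩
      symm := fun {x y} h => ⟨h.1.symm, by
        rw [← h.1, show y.w⁻¹ * x.w = (x.w⁻¹ * y.w)⁻¹ by group]
        exact inv_mem h.2⟩
      trans := fun {x y z} h h' => ⟨h.1.trans h'.1, by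
        rw [show x.w⁻¹ * z.w = (x.w⁻¹ * y.w) * (y.w⁻¹ * z.w) by group]
        refine mul_mem h.2 ?_
        rw [h.1]
        exact h'.2⟩ }
  mul' := by
    intro x x' y y' hx hy
    have hfix : ∀ {a b : D.FaceSemidirect},
        a.w⁻¹ * b.w ∈ fixingSubgroup D.weylGroup a.face.carrier →
        ∀ v ∈ a.face.carrier, b.w • v = a.w • v := by
      intro a b hab v hv
      have h1 := (mem_fixingSubgroup_iff _).1 hab v hv
      rwa [mul_smul, inv_smul_eq_iff] at h1
    constructor
    · refine Face.ext_carrier fun v => ?_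
      rw [FaceSemidirect.mul_face, FaceSemidirect.mul_face, Face.mem_inter, Face.mem_inter,
        Face.mem_translate, Face.mem_translate, inv_inv, inv_inv, ← hx.1, ← hy.1]
      constructor
      · rintro ⟨h1, h2⟩
        exact ⟨by rw [hfix hy.2 v h2]; exact h1, h2⟩
      · rintro ⟨h1, h2⟩
        exact ⟨by rw [← hfix hy.2 v h2]; exact h1, h2⟩
    · refine (mem_fixingSubgroup_iff _).2 fun v hv => ?_
      rw [FaceSemidirect.mul_face, Face.mem_inter, Face.mem_translate, inv_inv] at hv
      rw [FaceSemidirect.mul_w, FaceSemidirect.mul_w, mul_smul, inv_smul_eq_iff, mul_smul,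
        mul_smul, hfix hy.2 v hv.2, hfix hx.2 _ hv.1]

/-- The face monoid `Ŵ` associated to the Weyl group. -/
def FaceMonoid : Type _ := D.faceCon.Quotient

instance : Monoid D.FaceMonoid := inferInstanceAs (Monoid D.faceCon.Quotient)

variable {D} in
/-- The element `σ⌈R⌉` of the face monoid. -/
def FaceMonoid.mk (σ : D.weylGroup) (R : D.Face) : D.FaceMonoid :=
  ((⟨σ, R⟩ : D.FaceSemidirect) : D.faceCon.Quotient)

variable {D} in
/-- The idempotent `⌈R⌉ = 1⌈R⌉` of the face monoid. -/
def FaceMonoid.idem (R : D.Face) : D.FaceMonoid := FaceMonoid.mk 1 R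

variable {D} in
/-- The Weyl group element `σ = σ⌈X⌉` of the face monoid. -/
def FaceMonoid.ofWeyl (σ : D.weylGroup) : D.FaceMonoid := FaceMonoid.mk σ (Face.whole D)

/-- The parabolic submonoid `Ŵ_J = W_J {⌈R⌉ | R ⊇ R(J^∞)}`. -/
def parabolicSubmonoid [Fintype ι] (J : Set ι) : Set D.FaceMonoid :=
  {x | ∃ w ∈ D.parabolic J, ∃ R : D.Face, D.specialFace (infinitePart A J) ⊆ R.carrier ∧
    x = FaceMonoid.ofWeyl w * FaceMonoid.idem R}

open Classical in
/-- The map `λ ↦ (σ⌈R⌉)λ` on the Tits cone: `σλ` if `λ ∈ R`, and `0` otherwise. -/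
def FaceSemidirect.titsMap (x : D.FaceSemidirect) (v : D.titsCone) : D.titsCone :=
  if (v : V) ∈ x.face.carrier then ⟨x.w • (v : V), D.smul_mem_titsCone x.w v.2⟩
  else ⟨0, D.zero_mem_titsCone⟩

theorem FaceSemidirect.coe_titsMap_of_mem {x : D.FaceSemidirect} {v : D.titsCone}
    (h : (v : V) ∈ x.face.carrier) : (x.titsMap D v : V) = x.w • (v : V) := by
  rw [FaceSemidirect.titsMap, if_pos h]

theorem FaceSemidirect.coe_titsMap_of_notMem {x : D.FaceSemidirect} {v : D.titsCone}
    (h : (v : V) ∉ x.face.carrier) : (x.titsMap D v : V) = 0 := by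
  rw [FaceSemidirect.titsMap, if_neg h]

theorem FaceSemidirect.titsMap_congr {x y : D.FaceSemidirect} (h : D.faceCon x y) :
    x.titsMap D = y.titsMap D := by
  obtain ⟨h1, h2⟩ : x.face = y.face ∧
    x.w⁻¹ * y.w ∈ fixingSubgroup D.weylGroup x.face.carrier := h
  funext v
  apply Subtype.ext
  by_cases hv : (v : V) ∈ x.face.carrier
  · rw [coe_titsMap_of_mem D hv, coe_titsMap_of_mem D (h1 ▸ hv)]
    have h3 := (mem_fixingSubgroup_iff _).1 h2 v hv
    rw [mul_smul, inv_smul_eq_iff] at h3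
    exact h3.symm
  · rw [coe_titsMap_of_notMem D hv, coe_titsMap_of_notMem D (h1 ▸ hv)]

theorem FaceSemidirect.titsMap_mul (x y : D.FaceSemidirect) (v : D.titsCone) :
    (x * y).titsMap D v = x.titsMap D (y.titsMap D v) := by
  apply Subtype.ext
  have hz : ∀ u : D.titsCone, (u : V) = 0 → (x.titsMap D u : V) = 0 := by
    intro u hu
    by_cases h : (u : V) ∈ x.face.carrier
    · rw [coe_titsMap_of_mem D h, hu, smul_zero]
    · exact coe_titsMap_of_notMem D h
  have hm : (v : V) ∈ (x * y).face.carrier ↔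
      y.w • (v : V) ∈ x.face.carrier ∧ (v : V) ∈ y.face.carrier := by
    rw [mul_face, Face.mem_inter, Face.mem_translate, inv_inv]
  by_cases hy : (v : V) ∈ y.face.carrier
  · have hyv := coe_titsMap_of_mem D hy
    by_cases hx : y.w • (v : V) ∈ x.face.carrier
    · rw [coe_titsMap_of_mem D (hm.2 ⟨hx, hy⟩), mul_w, mul_smul,
        coe_titsMap_of_mem D (by rw [hyv]; exact hx), hyv]
    · rw [coe_titsMap_of_notMem D fun h => hx (hm.1 h).1,
        coe_titsMap_of_notMem D (by rw [hyv]; exact hx)]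
  · rw [coe_titsMap_of_notMem D fun h => hy (hm.1 h).2, hz _ (coe_titsMap_of_notMem D hy)]

/-- The action of the face monoid on the Tits cone: `(σ⌈R⌉)λ` is `σλ` if `λ ∈ R`, and `0`
otherwise. -/
instance : MulAction D.FaceMonoid D.titsCone where
  smul x v := Con.liftOn (c := D.faceCon) x (fun y => y.titsMap D v)
    fun _ _ h => congrFun (FaceSemidirect.titsMap_congr D h) v
  one_smul v := Subtype.ext <| by
    change ((1 : D.FaceSemidirect).titsMap D v : V) = v
    rw [FaceSemidirect.coe_titsMap_of_mem D (Face.mem_whole_of_mem_titsCone D v.2)]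
    exact one_smul D.weylGroup (v : V)
  mul_smul x y v := by
    induction x, y using Con.induction_on₂ with
    | _ a b => exact FaceSemidirect.titsMap_mul D a b v

/-! ### The Coxeter complex -/

/-- The Coxeter complex: all cosets `σ W_J`. -/
structure CoxeterComplex where
  carrier : Set D.weylGroup
  isCoset : ∃ (σ : D.weylGroup) (J : Set ι), carrier = {τ | ∃ w ∈ D.parabolic J, τ = σ * w}

/-- The coset `σ W_J` as an element of the Coxeter complex. -/
def coset (σ : D.weylGroup) (J : Set ι) : D.CoxeterComplex :=
  ⟨{τ | ∃ w ∈ D.parabolic J, τ = σ * w}, σ, J, rfl⟩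

variable {D} in
theorem CoxeterComplex.carrier_injective :
    Function.Injective (CoxeterComplex.carrier (D := D)) := by
  rintro ⟨a, _⟩ ⟨b, _⟩ h
  cases h
  rfl

/-- The Coxeter complex is ordered by reverse inclusion. -/
instance : PartialOrder D.CoxeterComplex where
  le c c' := c'.carrier ⊆ c.carrier
  le_refl c := subset_rfl
  le_trans _ _ _ h h' := h'.trans h
  le_antisymm _ _ h h' := CoxeterComplex.carrier_injective (subset_antisymm h' h)

/-- The subset `W_{Θ^⊥} (W_Θ ↓)` of the Coxeter complex: all `a v W_K` with `a ∈ W_{Θ^⊥}` and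
`v W_K ≤ W_Θ`. -/
def sweep (Θ : Set ι) : Set D.CoxeterComplex :=
  {c | ∃ a ∈ D.parabolic (orthSet A Θ), ∃ (v : D.weylGroup) (K : Set ι),
    D.coset v K ≤ D.coset 1 Θ ∧ c = D.coset (a * v) K}

/-- The open facet `τ F_J` of the Tits cone that corresponds to the element `τ W_J` of the Coxeter
complex. -/
def facetOf (c : D.CoxeterComplex) : Set V :=
  {v | ∃ (τ : D.weylGroup) (J : Set ι), c = D.coset τ J ∧ ∃ u ∈ D.openFacet J, v = τ • u}

/-- The action `act` of the face monoid on the Coxeter complex is given, on all elements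
`σ₁⌈R(Θ)⌉σ₂` with `Θ` special, by the formula
`σ₁⌈R(Θ)⌉σ₂ • τW_J = σ₁σ₂τW_J` if `σ₂τW_J ∈ W_{Θ^⊥}(W_Θ ↓)`, and `= W_I` otherwise. -/
def IsBadAction [Fintype ι] (act : MulAction D.FaceMonoid D.CoxeterComplex) : Prop :=
  ∀ (Θ : Set ι) (R : D.Face), IsSpecial A Θ → R.carrier = D.specialFace Θ →
    ∀ (σ₁ σ₂ τ : D.weylGroup) (J : Set ι),
      (D.coset (σ₂ * τ) J ∈ D.sweep Θ →
        (FaceMonoid.ofWeyl σ₁ * FaceMonoid.idem R * FaceMonoid.ofWeyl σ₂) • D.coset τ J =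
          D.coset (σ₁ * σ₂ * τ) J) ∧
      (D.coset (σ₂ * τ) J ∉ D.sweep Θ →
        (FaceMonoid.ofWeyl σ₁ * FaceMonoid.idem R * FaceMonoid.ofWeyl σ₂) • D.coset τ J =
          D.coset 1 Set.univ)

/-- The action `act` of the face monoid on the Coxeter complex preserves the order. -/
def IsOrderPreserving (act : MulAction D.FaceMonoid D.CoxeterComplex) : Prop :=
  ∀ (x : D.FaceMonoid) (c c' : D.CoxeterComplex), c ≤ c' → x • c ≤ x • c'

end FreeRealization

end

noncomputable section

namespace FreeRealization

variable {ι : Type*} {A : Matrix ι ι ℤ} {V : Type*} [AddCommGroup V] [Module ℝ V]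
  (D : FreeRealization A V)

/-! ### Words and length -/

/-! The action on cosets is read off from the action on the Tits cone X. The open facets are
disjoint and correspond to the cosets (`eq_of_mem_facetOf`). A face of X that meets an open facet
contains it (`Face.smul_openFacet_mem`). Hence σ⌈R⌉ either moves a whole facet τF_J by σ or sends it
to 0, which lies in the facet F_I. This gives a map on cosets (`exists_smul_mem_facetOf`), and the
action laws follow by tracing one vector of a facet. The explicit formula amounts to saying that a
facet lies in R(Θ) exactly when its coset lies in the sweep (`coset_mem_sweep_iff`). Faithfulness,
the stabilizers and the failure of monotonicity are then short computations with facets.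

The work lies in the geometry of X. The link between length and signs of coroots
(`coroot_smul_nonneg_of_length_le`) comes from an exchange argument in rank two. It shows that the
closed chamber is a fundamental domain with parabolic stabilizers
(`eq_and_mem_parabolic_of_smul_mem`) and that X is convex (`coe_titsConvexCone`).

For the faces there are two inputs from the theory of generalized Cartan matrices. For special Θ
there is a positive combination of the h_i, i ∈ Θ, that is nonpositive on all simple roots
(`IsGCM.exists_pos_of_isSpecial`). It is nonnegative on X and cuts out R(Θ), so R(Θ) is a face, and
it equals X ∩ {h_i = 0, i ∈ Θ} (`mem_specialFace_iff`). In finite type X is the whole space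
(`titsCone_eq_univ`). Therefore any vector can be made dominant for the finite part of J, and F_J
lies in the relative interior of R(J^∞) (`exists_sub_smul_mem_titsCone`). Consequently every face is
a translate of some R(Θ) (`Face.exists_eq_translate`). -/

theorem simple_smul (i : ι) (v : V) : D.simple i • v = v - D.coroot i v • D.root i := by
  change D.simpleReflection i v = _
  rw [simpleReflection, Module.reflection_apply]

theorem smul_real_smul (w : D.weylGroup) (r : ℝ) (v : V) : w • (r • v) = r • (w • v) :=
  smul_comm w r v

theorem weyl_ext {w w' : D.weylGroup} (h : ∀ v : V, w • v = w' • v) : w = w' :=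
  Subtype.ext (LinearEquiv.ext h)

theorem simple_mul_self (i : ι) : D.simple i * D.simple i = 1 := by
  refine D.weyl_ext fun v => ?_
  rw [mul_smul, simple_smul, simple_smul, map_sub, map_smul, D.coroot_root_self, one_smul,
    smul_eq_mul]
  module

theorem simple_inv (i : ι) : (D.simple i)⁻¹ = D.simple i :=
  inv_eq_of_mul_eq_one_left (D.simple_mul_self i)

theorem simple_mul_simple_mul (i : ι) (w : D.weylGroup) : D.simple i * (D.simple i * w) = w := by
  rw [← mul_assoc, D.simple_mul_self, one_mul]

theorem coroot_simple_smul_self (i : ι) (v : V) :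
    D.coroot i (D.simple i • v) = -D.coroot i v := by
  rw [simple_smul, map_sub, map_smul, D.coroot_root_self, smul_eq_mul]; ring

/-- The product of the simple reflections in a word. -/
def wordProd (L : List ι) : D.weylGroup := (L.map D.simple).prod

@[simp] theorem wordProd_nil : D.wordProd [] = 1 := rfl

@[simp] theorem wordProd_cons (i : ι) (L : List ι) :
    D.wordProd (i :: L) = D.simple i * D.wordProd L := by
  simp [wordProd]

@[simp] theorem wordProd_append (L L' : List ι) :
    D.wordProd (L ++ L') = D.wordProd L * D.wordProd L' := by
  simp [wordProd]

@[elab_as_elim]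
theorem weyl_induction {p : D.weylGroup → Prop} (one : p 1)
    (simple_mul : ∀ i w, p w → p (D.simple i * w)) (w : D.weylGroup) : p w := by
  obtain ⟨w, hw⟩ := w
  induction hw using Subgroup.closure_induction_left with
  | one => exact one
  | mul_left x hx y hy ih =>
    obtain ⟨i, rfl⟩ := hx
    exact simple_mul i ⟨y, hy⟩ ih
  | inv_mul_cancel x hx y hy ih =>
    obtain ⟨i, rfl⟩ := hx
    have := simple_mul i ⟨y, hy⟩ ih
    rw [← D.simple_inv] at this
    exact this

theorem exists_word (w : D.weylGroup) : ∃ L : List ι, D.wordProd L = w := by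
  induction w using D.weyl_induction with
  | one => exact ⟨[], rfl⟩
  | simple_mul i w ih =>
    obtain ⟨L, rfl⟩ := ih
    exact ⟨i :: L, D.wordProd_cons i L⟩

/-- The length of an element of the Weyl group with respect to the simple reflections. -/
def length (w : D.weylGroup) : ℕ := sInf {n | ∃ L : List ι, D.wordProd L = w ∧ L.length = n}

theorem exists_reduced_word (w : D.weylGroup) :
    ∃ L : List ι, D.wordProd L = w ∧ L.length = D.length w := by
  have h : {n | ∃ L : List ι, D.wordProd L = w ∧ L.length = n}.Nonempty := by
    obtain ⟨L, hL⟩ := D.exists_word w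
    exact ⟨_, L, hL, rfl⟩
  exact Nat.sInf_mem h

theorem length_wordProd_le (L : List ι) : D.length (D.wordProd L) ≤ L.length :=
  Nat.sInf_le ⟨L, rfl, rfl⟩

theorem length_wordProd_mul_le (L : List ι) (w : D.weylGroup) :
    D.length (D.wordProd L * w) ≤ L.length + D.length w := by
  obtain ⟨L', rfl, hL'⟩ := D.exists_reduced_word w
  rw [← wordProd_append, ← hL', ← List.length_append]
  exact D.length_wordProd_le _

/-- Delete the first letter of a reduced word. All later inductions on length descend in this way.
-/
theorem exists_simple_mul_length_lt {w : D.weylGroup} (hw : w ≠ 1) :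
    ∃ i, D.length w = D.length (D.simple i * w) + 1 := by
  obtain ⟨L, rfl, hL⟩ := D.exists_reduced_word w
  cases L with
  | nil => exact absurd rfl hw
  | cons i L =>
    refine ⟨i, ?_⟩
    have h1 := D.length_wordProd_mul_le [i] (D.wordProd L)
    have h2 := D.length_wordProd_le L
    simp only [wordProd_cons, wordProd_nil, mul_one, List.length_cons, List.length_nil] at h1 hL ⊢
    rw [simple_mul_simple_mul]
    omega

/-! ### The rank two exchange property -/

/-- If the integers x, y had opposite signs, then x², y² ≥ 1 and the mixed term would be
nonnegative, so the form would be at least c₁ + c₂ > c₁. -/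
theorem rank_two_sign {c₁ c₂ q x y : ℤ} (h₁ : 0 < c₁) (h₂ : 0 < c₂) (hq : 0 ≤ q)
    (hQ : c₁ * x ^ 2 - c₁ * q * (x * y) + c₂ * y ^ 2 = c₁) :
    0 ≤ x * y := by
  by_contra! h
  have hx : 1 ≤ x ^ 2 := by
    have : x ≠ 0 := by rintro rfl; simp at h
    have := sq_pos_of_ne_zero this
    omega
  have hy : 1 ≤ y ^ 2 := by
    have : y ≠ 0 := by rintro rfl; simp at h
    have := sq_pos_of_ne_zero this
    omega
  have h3 : 0 ≤ c₁ * q := by positivity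
  nlinarith

/-- In the rank two parabolic subgroup generated by two simple reflections, an element either
keeps the simple coroot `h_j` positive or is shortened by multiplication with `σ_j`. -/
theorem rank_two_exchange {j t : ι} (hjt : j ≠ t) (L : List ι) (hL : ∀ i ∈ L, i = j ∨ i = t) :
    (∃ x y : ℝ, 0 ≤ x ∧ 0 ≤ y ∧
      ∀ v, D.coroot j (D.wordProd L • v) = x * D.coroot j v + y * D.coroot t v) ∨
    ∃ L' : List ι, (∀ i ∈ L', i = j ∨ i = t) ∧ L'.length < L.length ∧
      D.simple j * D.wordProd L = D.wordProd L' := by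
  obtain ⟨p, hp⟩ : ∃ p, A j t = -p := ⟨-A j t, by ring⟩
  obtain ⟨q, hq⟩ : ∃ q, A t j = -q := ⟨-A t j, by ring⟩
  have hp0 : 0 ≤ p := by have := D.isGCM.nonpos j t hjt; omega
  have hq0 : 0 ≤ q := by have := D.isGCM.nonpos t j hjt.symm; omega
  -- The weights c₁, c₂ symmetrize the 2 × 2 block, so that an invariant quadratic form is
  -- available.
  obtain ⟨c₁, c₂, h₁, h₂, hc⟩ : ∃ c₁ c₂ : ℤ, 0 < c₁ ∧ 0 < c₂ ∧ c₁ * q = c₂ * p := by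
    by_cases h : p = 0
    · have : q = 0 := by
        have := D.isGCM.zero_symm j t (by rw [hp, h]; rfl)
        omega
      exact ⟨1, 1, one_pos, one_pos, by rw [h, this]⟩
    · have : q ≠ 0 := by
        intro h'
        have := D.isGCM.zero_symm t j (by rw [hq, h']; rfl)
        omega
      exact ⟨p, q, by omega, by omega, mul_comm p q⟩
  have hjj := D.coroot_root_self j
  have htt := D.coroot_root_self t
  have hjt' : D.coroot j (D.root t) = -(p : ℝ) := by rw [D.coroot_root, hp]; push_cast; rfl
  have htj' : D.coroot t (D.root j) = -(q : ℝ) := by rw [D.coroot_root, hq]; push_cast; rfl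
  have hcR : (c₁ : ℝ) * q = c₂ * p := by exact_mod_cast hc
  -- The induction carries the coordinates of h_j ∘ w together with those of the root w⁻¹α_j and the
  -- value c₁ of the invariant form. Once h_j ∘ w is a multiple z·h_m and w⁻¹α_j = z⁻¹α_m, it
  -- follows that σ_j w = w σ_m, which gives the shortening.
  suffices H : (∃ x y : ℤ, 0 ≤ x ∧ 0 ≤ y ∧
      c₁ * x ^ 2 - c₁ * q * (x * y) + c₂ * y ^ 2 = c₁ ∧
      (∀ v, D.coroot j (D.wordProd L • v) = x * D.coroot j v + y * D.coroot t v) ∧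
      (c₁ : ℝ) • ((D.wordProd L)⁻¹ • D.root j) =
        (c₁ * x : ℝ) • D.root j + (c₂ * y : ℝ) • D.root t) ∨
      ∃ L' : List ι, (∀ i ∈ L', i = j ∨ i = t) ∧ L'.length < L.length ∧
      D.simple j * D.wordProd L = D.wordProd L' by
    rcases H with ⟨x, y, hx, hy, -, h, -⟩ | H
    · exact Or.inl ⟨x, y, by exact_mod_cast hx, by exact_mod_cast hy, h⟩
    · exact Or.inr H
  induction L using List.reverseRecOn with
  | nil =>
    refine Or.inl ⟨1, 0, by norm_num, le_rfl, by ring, fun v => by simp, by simp⟩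
  | append_singleton L m ih =>
    have hm : m = j ∨ m = t := hL m (by simp)
    have hL1 : ∀ i ∈ L, i = j ∨ i = t := fun i hi => hL i (by simp [hi])
    rcases ih hL1 with ⟨x, y, hx, hy, hQ, hf, hr⟩ | ⟨L', h1, h2, h3⟩
    · have hexch : ∀ (m : ι) (z : ℝ), z ≠ 0 →
          (∀ v, D.coroot j (D.wordProd L • v) = z * D.coroot m v) →
          (D.wordProd L)⁻¹ • D.root j = z⁻¹ • D.root m →
          D.simple j * D.wordProd (L ++ [m]) = D.wordProd L := by
        intro m z hz hf hr
        have : D.simple j * D.wordProd L = D.wordProd L * D.simple m := by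
          refine D.weyl_ext fun v => ?_
          rw [inv_smul_eq_iff, smul_real_smul] at hr
          rw [mul_smul, mul_smul, simple_smul, simple_smul, hf, smul_sub, smul_real_smul, hr,
            smul_smul]
          congr 2
          field_simp
        rw [wordProd_append, ← mul_assoc, this, mul_assoc]
        simp [D.simple_mul_self]
      have hc1 : (c₁ : ℝ) ≠ 0 := by exact_mod_cast h₁.ne'
      have hinv : (D.wordProd (L ++ [m]))⁻¹ • D.root j =
          D.simple m • ((D.wordProd L)⁻¹ • D.root j) := by
        rw [wordProd_append, mul_inv_rev, mul_smul]
        simp [D.simple_inv]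
      have hfm : ∀ v, D.coroot j (D.wordProd (L ++ [m]) • v) =
          x * D.coroot j (D.simple m • v) + y * D.coroot t (D.simple m • v) := by
        intro v
        rw [wordProd_append, mul_smul, hf]
        simp
      have hrm : (c₁ : ℝ) • ((D.wordProd (L ++ [m]))⁻¹ • D.root j) =
          (c₁ * x : ℝ) • (D.simple m • D.root j) + (c₂ * y : ℝ) • (D.simple m • D.root t) := by
        rw [hinv, ← smul_real_smul, hr, smul_add, smul_real_smul, smul_real_smul]
      rcases hm with rfl | rfl
      · by_cases hneg : 0 ≤ q * y - x
        · refine Or.inl ⟨q * y - x, y, hneg, hy, by linear_combination hQ, fun v => ?_, ?_⟩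
          · rw [hfm, simple_smul, map_sub, map_sub, map_smul, map_smul, hjj, htj', smul_eq_mul,
              smul_eq_mul]
            push_cast; ring
          · rw [hrm, simple_smul, simple_smul, hjj, hjt']
            push_cast
            match_scalars <;> first | ring1 | linear_combination (-(y : ℝ)) * hcR
        -- The new coordinate is negative, so the sign lemma forces y = 0, and the form then gives x
        -- = 1.
        · have hs := rank_two_sign (x := q * y - x) (y := y) h₁ h₂ hq0
            (by linear_combination hQ)
          have hy0 : y = 0 := by
            by_contra h
            have : 0 < y := by omega
            nlinarith
          subst hy0
          have hx1 : x = 1 := by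
            have : c₁ * x ^ 2 = c₁ * 1 := by linear_combination hQ
            have := mul_left_cancel₀ h₁.ne' this
            nlinarith
          subst hx1
          refine Or.inr ⟨L, hL1, by simp, hexch m 1 one_ne_zero (fun v => ?_) ?_⟩
          · rw [hf]; simp
          · have : (c₁ : ℝ) • ((D.wordProd L)⁻¹ • D.root m) = (c₁ : ℝ) • D.root m := by
              rw [hr]; simp
            rw [inv_one, one_smul]
            exact smul_right_injective V hc1 this
      · by_cases hneg : 0 ≤ p * x - y
        · refine Or.inl ⟨x, p * x - y, hx, hneg, ?_, fun v => ?_, ?_⟩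
          · linear_combination hQ - (p * x ^ 2 - 2 * x * y) * hc
          · rw [hfm, simple_smul, map_sub, map_sub, map_smul, map_smul, htt, hjt', smul_eq_mul,
              smul_eq_mul]
            push_cast; ring
          · rw [hrm, simple_smul, simple_smul, htt, htj']
            push_cast
            match_scalars <;> first | ring1 | linear_combination (x : ℝ) * hcR
        · have hs := rank_two_sign (x := x) (y := p * x - y) h₁ h₂ hq0
            (by linear_combination hQ - (p * x ^ 2 - 2 * x * y) * hc)
          have hx0 : x = 0 := by
            by_contra h
            have : 0 < x := by omega
            nlinarith
          subst hx0
          have hy0 : 0 < y := by omega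
          have hyR : (y : ℝ) ≠ 0 := by exact_mod_cast hy0.ne'
          have hQ' : (c₂ : ℝ) * y ^ 2 = c₁ := by
            have : c₂ * y ^ 2 = c₁ := by linear_combination hQ
            exact_mod_cast this
          refine Or.inr ⟨L, hL1, by simp, hexch m y hyR (fun v => ?_) ?_⟩
          · rw [hf]; simp
          · have : (c₁ : ℝ) • ((D.wordProd L)⁻¹ • D.root j) =
                (c₁ : ℝ) • ((y : ℝ)⁻¹ • D.root m) := by
              rw [hr, smul_smul, ← hQ']
              simp only [Int.cast_zero, mul_zero, zero_smul, zero_add]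
              congr 1
              field_simp
            exact smul_right_injective V hc1 this
    · refine Or.inr ⟨L' ++ [m], ?_, by simpa using h2, ?_⟩
      · intro i hi
        rcases List.mem_append.1 hi with hi | hi
        · exact h1 i hi
        · rw [List.mem_singleton.1 hi]; exact hm
      · rw [wordProd_append, ← mul_assoc, h3, wordProd_append]

/-! ### Chambers and length -/

/-- If `σ_j w` is not shorter than `w`, then `h_j` is nonnegative on `w C̄`. -/
theorem coroot_smul_nonneg_of_length_le {w : D.weylGroup} {j : ι}
    (h : D.length w ≤ D.length (D.simple j * w)) {u : V} (hu : u ∈ D.closedChamber) :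
    0 ≤ D.coroot j (w • u) := by
  induction hn : D.length w using Nat.strong_induction_on generalizing w j with
  | _ n ih =>
    subst hn
    by_cases hw : w = 1
    · subst hw; rw [one_smul]; exact hu j
    obtain ⟨t, ht⟩ := D.exists_simple_mul_length_lt hw
    have hjt : j ≠ t := by rintro rfl; omega
    -- Factor w = L·v with L a word in j and t, lengths adding, and v as short as possible. Then
    -- neither σ_j nor σ_t shortens v, so by induction h_j and h_t are nonnegative on vC̄, and only
    -- the rank two word L remains to be treated.
    let P : ℕ → Prop := fun n => ∃ (L : List ι) (v : D.weylGroup), (∀ i ∈ L, i = j ∨ i = t) ∧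
      w = D.wordProd L * v ∧ L.length + D.length v = D.length w ∧ D.length v = n
    have hP : P (D.length (D.simple t * w)) :=
      ⟨[t], D.simple t * w, by simp, by simp [simple_mul_simple_mul], by simp; omega, rfl⟩
    classical
    have hex : ∃ n, P n := ⟨_, hP⟩
    obtain ⟨L, v, hL, hwv, hlen, hv⟩ := Nat.find_spec hex
    have hvlt : D.length v < D.length w := by
      have := Nat.find_min' hex hP
      omega
    have hmin : ∀ s, s = j ∨ s = t → D.length v ≤ D.length (D.simple s * v) := by
      intro s hs
      by_contra! hlt
      have hw' : w = D.wordProd (L ++ [s]) * (D.simple s * v) := by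
        rw [hwv, wordProd_append, mul_assoc]
        simp [simple_mul_simple_mul]
      have hle := D.length_wordProd_mul_le (L ++ [s]) (D.simple s * v)
      rw [← hw', List.length_append, List.length_singleton] at hle
      have := Nat.find_min' hex ⟨L ++ [s], D.simple s * v, by
        intro i hi
        rcases List.mem_append.1 hi with hi | hi
        · exact hL i hi
        · rw [List.mem_singleton.1 hi]; exact hs, hw', by
        rw [List.length_append, List.length_singleton]; omega, rfl⟩
      omega
    have hj := ih _ hvlt (hmin j (Or.inl rfl)) rfl
    have ht := ih _ hvlt (hmin t (Or.inr rfl)) rfl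
    rcases D.rank_two_exchange hjt L hL with ⟨x, y, hx, hy, hxy⟩ | ⟨L', -, hlt, hL'⟩
    · rw [hwv, mul_smul, hxy]
      positivity
    · exfalso
      have := D.length_wordProd_mul_le L' v
      rw [← hL', mul_assoc, ← hwv] at this
      omega

theorem length_simple_mul_lt {w : D.weylGroup} {j : ι} {u : V} (hu : u ∈ D.closedChamber)
    (h : D.coroot j (w • u) < 0) : D.length (D.simple j * w) < D.length w := by
  by_contra! h'
  exact absurd (D.coroot_smul_nonneg_of_length_le h' hu) h.not_ge

/-! ### Standard parabolic subgroups and the fundamental domain. -/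

theorem simple_mem_parabolic {i : ι} {J : Set ι} (hi : i ∈ J) : D.simple i ∈ D.parabolic J :=
  Subgroup.subset_closure (Set.mem_image_of_mem _ hi)

/-- Induction along simple reflections in a standard parabolic subgroup. -/
@[elab_as_elim]
theorem parabolic_induction {J : Set ι} {p : (w : D.weylGroup) → w ∈ D.parabolic J → Prop}
    (one : p 1 (one_mem _))
    (simple_mul : ∀ i (hi : i ∈ J) w (hw : w ∈ D.parabolic J), p w hw →
      p (D.simple i * w) (mul_mem (D.simple_mem_parabolic hi) hw)) {w : D.weylGroup}
    (hw : w ∈ D.parabolic J) : p w hw := by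
  refine Subgroup.closure_induction_left one ?_ ?_ hw
  · rintro _ ⟨i, hi, rfl⟩ y hy ih
    exact simple_mul i hi y hy ih
  · rintro _ ⟨i, hi, rfl⟩ y hy ih
    have := simple_mul i hi y hy ih
    simpa only [simple_inv] using this

theorem parabolic_mono {J K : Set ι} (h : J ⊆ K) : D.parabolic J ≤ D.parabolic K :=
  Subgroup.closure_mono (Set.image_mono h)

theorem smul_eq_self_of_mem_parabolic {J : Set ι} {w : D.weylGroup} (hw : w ∈ D.parabolic J)
    {v : V} (hv : ∀ i ∈ J, D.coroot i v = 0) : w • v = v := by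
  induction hw using D.parabolic_induction with
  | one => exact one_smul _ _
  | simple_mul i hi w _ ih => rw [mul_smul, ih, simple_smul, hv i hi, zero_smul, sub_zero]

theorem coroot_smul_of_mem_parabolic {J : Set ι} {w : D.weylGroup} (hw : w ∈ D.parabolic J)
    {k : ι} (hk : ∀ i ∈ J, A k i = 0) (v : V) : D.coroot k (w • v) = D.coroot k v := by
  induction hw using D.parabolic_induction with
  | one => rw [one_smul]
  | simple_mul i hi w _ ih =>
    rw [mul_smul, simple_smul, map_sub, ih, map_smul, D.coroot_root, hk i hi]; simp

/-- The closed fundamental chamber is a fundamental domain, and stabilizers are parabolic. -/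
theorem eq_and_mem_parabolic_of_smul_mem {w : D.weylGroup} {u : V} (hu : u ∈ D.closedChamber)
    (hwu : w • u ∈ D.closedChamber) : w • u = u ∧ w ∈ D.parabolic {i | D.coroot i u = 0} := by
  induction hn : D.length w using Nat.strong_induction_on generalizing w with
  | _ n ih =>
    subst hn
    by_cases hw : w = 1
    · subst hw; exact ⟨one_smul _ _, one_mem _⟩
    obtain ⟨j, hj⟩ := D.exists_simple_mul_length_lt hw
    -- Since σ_j w is shorter, h_j ≥ 0 at σ_j w u, that is h_j(wu) ≤ 0. As wu is dominant, it lies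
    -- on the wall of σ_j, so σ_j can be removed without moving wu.
    have h1 : 0 ≤ D.coroot j ((D.simple j * w) • u) := by
      have : D.length (D.simple j * w) ≤ D.length (D.simple j * (D.simple j * w)) := by
        rw [simple_mul_simple_mul]; omega
      exact D.coroot_smul_nonneg_of_length_le this hu
    rw [mul_smul, coroot_simple_smul_self] at h1
    have h2 : D.coroot j (w • u) = 0 := le_antisymm (by linarith) (hwu j)
    have h3 : (D.simple j * w) • u = w • u := by
      rw [mul_smul, simple_smul, h2, zero_smul, sub_zero]
    obtain ⟨h4, h5⟩ := ih (D.length (D.simple j * w)) (by omega) (by rw [h3]; exact hwu) rfl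
    have h6 : w • u = u := h3.symm.trans h4
    refine ⟨h6, ?_⟩
    rw [← D.simple_mul_simple_mul j w]
    exact mul_mem (D.simple_mem_parabolic (by rw [← h6]; exact h2)) h5

theorem openFacet_subset_closedChamber (J : Set ι) : D.openFacet J ⊆ D.closedChamber := by
  intro v hv i
  by_cases hi : i ∈ J
  · exact (hv.1 i hi).ge
  · exact (hv.2 i hi).le

theorem closedFacet_subset_closedChamber (J : Set ι) : D.closedFacet J ⊆ D.closedChamber := by
  intro v hv i
  by_cases hi : i ∈ J
  · exact (hv.1 i hi).ge
  · exact hv.2 i hi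

theorem mem_openFacet_iff {J : Set ι} {v : V} :
    v ∈ D.openFacet J ↔ v ∈ D.closedChamber ∧ {i | D.coroot i v = 0} = J := by
  constructor
  · intro h
    refine ⟨D.openFacet_subset_closedChamber J h,
      Set.ext fun i => ⟨fun hi => ?_, fun hi => h.1 i hi⟩⟩
    by_contra hiJ
    exact (h.2 i hiJ).ne' hi
  · rintro ⟨h, rfl⟩
    exact ⟨fun i hi => hi, fun i hi => lt_of_le_of_ne (h i) (Ne.symm hi)⟩

theorem mem_closedFacet_iff {J : Set ι} {v : V} :
    v ∈ D.closedFacet J ↔ v ∈ D.closedChamber ∧ J ⊆ {i | D.coroot i v = 0} := by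
  constructor
  · exact fun h => ⟨D.closedFacet_subset_closedChamber J h, h.1⟩
  · exact fun h => ⟨fun i hi => h.2 hi, fun i _ => h.1 i⟩

theorem closedChamber_subset_titsCone : D.closedChamber ⊆ D.titsCone :=
  fun u hu => ⟨1, u, hu, (one_smul _ _).symm⟩

theorem real_smul_mem_titsCone {r : ℝ} (hr : 0 ≤ r) {x : V} (hx : x ∈ D.titsCone) :
    r • x ∈ D.titsCone := by
  obtain ⟨w, u, hu, rfl⟩ := hx
  refine ⟨w, r • u, fun i => ?_, (D.smul_real_smul w r u).symm⟩
  rw [map_smul, smul_eq_mul]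
  exact mul_nonneg hr (hu i)

/-! ### Existence of points in facets, and convexity of the Tits cone. -/

section Finite

variable [Finite ι]

/-- Linear independence of the coroots says that the transpose of v ↦ (h_i(v))_i is injective, so
this map is surjective. -/
theorem exists_coroot_eq (c : ι → ℝ) : ∃ v : V, ∀ i, D.coroot i v = c i := by
  have := Fintype.ofFinite ι
  classical
  have hsurj : Function.Surjective (LinearMap.pi D.coroot) := by
    rw [← LinearMap.dualMap_injective_iff, ← LinearMap.ker_eq_bot, LinearMap.ker_eq_bot']
    intro φ hφ
    have hli := Fintype.linearIndependent_iff.1 D.linearIndependent_coroot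
      (fun i => φ (Pi.single i 1)) ?_
    · refine LinearMap.pi_ext' fun i => LinearMap.ext_ring ?_
      simpa using hli i
    · ext v
      have h := LinearMap.congr_fun hφ v
      simp only [LinearMap.dualMap_apply, LinearMap.zero_apply] at h
      rw [LinearMap.pi_apply_eq_sum_univ φ] at h
      have hs : ∀ i : ι, (fun j => if i = j then (1 : ℝ) else 0) = Pi.single i 1 := fun i => by
        ext j; simp [Pi.single_apply, eq_comm]
      simpa [LinearMap.sum_apply, mul_comm, hs] using h
  obtain ⟨v, hv⟩ := hsurj c
  exact ⟨v, fun i => congrFun hv i⟩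

theorem openFacet_nonempty (J : Set ι) : (D.openFacet J).Nonempty := by
  classical
  obtain ⟨v, hv⟩ := D.exists_coroot_eq (fun i => if i ∈ J then 0 else 1)
  refine ⟨v, fun i hi => ?_, fun i hi => ?_⟩
  · rw [hv, if_pos hi]
  · rw [hv, if_neg hi]; exact one_pos

/-- `x + wy` lies in the Tits cone for `x`, `y` in the closed chamber. -/
theorem add_smul_mem_titsCone {x y : V} (hx : x ∈ D.closedChamber) (hy : y ∈ D.closedChamber)
    (w : D.weylGroup) : x + w • y ∈ D.titsCone := by
  have := Fintype.ofFinite ι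
  induction hn : D.length w using Nat.strong_induction_on generalizing w x y with
  | _ n ih =>
    subst hn
    classical
    by_cases hc : x + w • y ∈ D.closedChamber
    · exact D.closedChamber_subset_titsCone hc
    let S : Finset ι := Finset.univ.filter fun j => D.coroot j (w • y) < 0
    have hS : S.Nonempty := by
      by_contra hS
      refine hc fun i => ?_
      have : ¬ D.coroot i (w • y) < 0 := fun h => hS ⟨i, by simp [S, h]⟩
      rw [map_add]
      exact add_nonneg (hx i) (not_lt.1 this)
    obtain ⟨j, hjS, hjmin⟩ := S.exists_min_image
      (fun j => D.coroot j x / (-D.coroot j (w • y))) hS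
    have hj : D.coroot j (w • y) < 0 := by simpa [S] using hjS
    -- The point z = x + t·wy is where the segment from x to x + wy leaves the closed chamber,
    -- through the wall of σ_j. As σ_j fixes z and h_j(wy) < 0, applying σ_j to x + wy = z + (1 -
    -- t)·wy gives a sum of the same shape with the shorter element σ_j w.
    obtain ⟨t, ht⟩ : ∃ t, t = D.coroot j x / (-D.coroot j (w • y)) := ⟨_, rfl⟩
    have ht0 : 0 ≤ t := by rw [ht]; exact div_nonneg (hx j) (by linarith)
    have hmin : ∀ i, D.coroot i (w • y) < 0 → t * (-D.coroot i (w • y)) ≤ D.coroot i x := by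
      intro i hi
      have := hjmin i (by simp [S, hi])
      rw [← ht] at this
      rwa [le_div_iff₀ (by linarith)] at this
    have hz : x + t • (w • y) ∈ D.closedChamber := by
      intro i
      rw [map_add, map_smul, smul_eq_mul]
      by_cases hi : D.coroot i (w • y) < 0
      · linarith [hmin i hi]
      · have := mul_nonneg ht0 (not_lt.1 hi)
        linarith [hx i]
    have hzj : D.coroot j (x + t • (w • y)) = 0 := by
      rw [map_add, map_smul, smul_eq_mul, ht]
      have := hj.ne
      field_simp
      ring
    have ht1 : t < 1 := by
      by_contra! h1
      refine hc fun i => ?_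
      rw [map_add]
      by_cases hi : D.coroot i (w • y) < 0
      · nlinarith [hmin i hi]
      · linarith [hx i]
    have hy' : (1 - t) • y ∈ D.closedChamber := fun i => by
      rw [map_smul, smul_eq_mul]
      exact mul_nonneg (by linarith) (hy i)
    have := D.smul_mem_titsCone (D.simple j)
      (ih _ (D.length_simple_mul_lt hy hj) hz hy' (D.simple j * w) rfl)
    convert this using 1
    rw [smul_add, ← mul_smul, simple_mul_simple_mul, smul_real_smul, D.simple_smul j (x + _), hzj]
    generalize w • y = z
    module

theorem add_mem_titsCone {x y : V} (hx : x ∈ D.titsCone) (hy : y ∈ D.titsCone) :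
    x + y ∈ D.titsCone := by
  obtain ⟨w, u, hu, rfl⟩ := hx
  obtain ⟨w', u', hu', rfl⟩ := hy
  have := D.smul_mem_titsCone w (D.add_smul_mem_titsCone hu hu' (w⁻¹ * w'))
  rwa [smul_add w, smul_smul, mul_inv_cancel_left] at this

/-- The Tits cone is a convex cone. -/
theorem coe_titsConvexCone : (D.titsConvexCone : Set V) = D.titsCone := by
  refine Set.Subset.antisymm (fun x hx => ?_) PointedCone.subset_hull
  change x ∈ Submodule.span {r : ℝ // 0 ≤ r} D.titsCone at hx
  induction hx using Submodule.span_induction with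
  | mem x hx => exact hx
  | zero => exact D.zero_mem_titsCone
  | add x y _ _ hx hy => exact D.add_mem_titsCone hx hy
  | smul a x _ hx => exact D.real_smul_mem_titsCone a.2 hx

theorem mem_titsConvexCone {v : V} : v ∈ D.titsConvexCone ↔ v ∈ D.titsCone := by
  rw [← D.coe_titsConvexCone]; rfl

end Finite

end FreeRealization

end

/-! ### Matrices of finite type and theorems of alternatives -/

/-- M. Riesz extension of the form te ↦ t from the line ℝe; -e ∉ s makes this form nonnegative on
the part of the line in s. -/
theorem PointedCone.exists_nonneg_functional {E : Type*} [AddCommGroup E] [Module ℝ E]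
    (s : PointedCone ℝ E) {e : E} (he : -e ∉ s) (hs : ∀ y, ∃ t : ℝ, t • e + y ∈ s) :
    ∃ g : E →ₗ[ℝ] ℝ, g e = 1 ∧ ∀ x ∈ s, 0 ≤ g x := by
  have he0 : e ≠ 0 := by
    rintro rfl
    rw [neg_zero] at he
    exact he s.zero_mem
  have H := riesz_extension s (LinearPMap.mkSpanSingleton e (1 : ℝ) he0) ?_ ?_
  · obtain ⟨g, hg, hgs⟩ := H
    refine ⟨g, ?_, hgs⟩
    have h := hg ⟨e, Submodule.mem_span_singleton_self e⟩
    rw [LinearPMap.mkSpanSingleton_apply] at h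
    exact h
  · rintro ⟨x, hx⟩ hxs
    obtain ⟨c, rfl⟩ := Submodule.mem_span_singleton.1 hx
    rw [LinearPMap.mkSpanSingleton'_apply, smul_eq_mul, mul_one]
    by_contra! hc
    rw [RingHom.id_apply] at hc
    refine he ?_
    have h := PointedCone.smul_mem s (r := (-c)⁻¹) (by rw [inv_nonneg]; linarith) hxs
    rw [smul_smul] at h
    have : (-c)⁻¹ * c = -1 := by
      have := hc.ne
      field_simp
    rwa [this, neg_one_smul] at h
  · intro y
    obtain ⟨t, ht⟩ := hs y
    exact ⟨⟨t • e, Submodule.smul_mem _ _ (Submodule.mem_span_singleton_self e)⟩, ht⟩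

section Matrices

variable {κ : Type*} [Fintype κ]

/-- Ville's theorem of the alternative. -/
theorem Matrix.exists_one_le_or_exists_nonpos (M : Matrix κ κ ℝ) :
    (∃ u : κ → ℝ, (∀ i, 0 ≤ u i) ∧ ∀ i, 1 ≤ M.mulVec u i) ∨
    ∃ f : κ → ℝ, (∀ i, 0 ≤ f i) ∧ f ≠ 0 ∧ ∀ j, Matrix.vecMul f M j ≤ 0 := by
  classical
  rw [or_iff_not_imp_left]
  intro hno
  -- The cone of all y with y ≥ -Mu for some u ≥ 0. It contains -1 exactly when the first
  -- alternative holds, and otherwise a form nonnegative on it, normalized at 1, has the required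
  -- coefficients.
  let s : PointedCone ℝ (κ → ℝ) :=
    { carrier := {y | ∃ u : κ → ℝ, (∀ i, 0 ≤ u i) ∧ ∀ i, -(M.mulVec u i) ≤ y i}
      zero_mem' := ⟨0, fun i => le_rfl, fun i => by simp⟩
      add_mem' := by
        rintro y y' ⟨u, hu, h⟩ ⟨u', hu', h'⟩
        refine ⟨u + u', fun i => add_nonneg (hu i) (hu' i), fun i => ?_⟩
        rw [Matrix.mulVec_add, Pi.add_apply, Pi.add_apply]
        linarith [h i, h' i]
      smul_mem' := by
        rintro ⟨c, hc⟩ y ⟨u, hu, h⟩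
        refine ⟨c • u, fun i => mul_nonneg hc (hu i), fun i => ?_⟩
        rw [Matrix.mulVec_smul]
        have := mul_le_mul_of_nonneg_left (h i) hc
        change -(c * _) ≤ c * y i
        linarith }
  have hnn : ∀ y : κ → ℝ, (∀ i, 0 ≤ y i) → y ∈ s := fun y hy =>
    ⟨0, fun i => le_rfl, fun i => by simpa using hy i⟩
  have H := PointedCone.exists_nonneg_functional s (e := 1) ?_ ?_
  · obtain ⟨g, hg1, hg⟩ := H
    have hgy : ∀ y, g y = ∑ i, y i * g (Pi.single i 1) := by
      intro y
      rw [LinearMap.pi_apply_eq_sum_univ g y]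
      refine Finset.sum_congr rfl fun i _ => ?_
      rw [smul_eq_mul]
      congr 2
      ext j; simp [Pi.single_apply, eq_comm]
    refine ⟨fun i => g (Pi.single i 1), fun i => hg _ (hnn _ fun j => ?_), ?_, fun j => ?_⟩
    · by_cases h : j = i
      · subst h; simp
      · simp [h]
    · intro h
      rw [hgy] at hg1
      simp only [funext_iff, Pi.zero_apply] at h
      simp [h] at hg1
    · have h := hg (-(M.mulVec (Pi.single j 1))) ⟨Pi.single j 1, fun i => ?_, fun i => le_rfl⟩
      · rw [map_neg, hgy] at h
        simp only [Matrix.mulVec_single_one, Matrix.col_apply] at h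
        rw [Matrix.vecMul, dotProduct]
        simp only [mul_comm (M _ j)] at h
        linarith
      · by_cases h : i = j
        · subst h; simp
        · simp [h]
  · rintro ⟨u, hu, h⟩
    exact hno ⟨u, hu, fun i => by have := h i; simp at this; linarith⟩
  · intro y
    refine ⟨∑ i, |y i|, hnn _ fun i => ?_⟩
    have h1 := Finset.single_le_sum (f := fun i => |y i|) (fun i _ => abs_nonneg _)
      (Finset.mem_univ i)
    have h2 := neg_abs_le (y i)
    simp only [Pi.add_apply, Pi.smul_apply, Pi.one_apply, smul_eq_mul, mul_one]
    linarith

/-! ### Indecomposable generalized Cartan matrices. -/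

variable [DecidableEq κ] {B : Matrix κ κ ℤ}

/-- Minimum principle: at an index i minimizing m = v_i/u_i the signs off the diagonal give (Bv)_i ≤
m(Bu)_i, so Bv ≥ 0 excludes m < 0. Applied to ±v this makes B injective. A zero of v spreads to all
neighbours, hence everywhere by connectedness. -/
theorem IsGCM.isFiniteType_of_pos (hB : IsGCM B)
    (hconn : ∀ i j, Relation.ReflTransGen (fun a b => B a b ≠ 0) i j)
    {u : κ → ℝ} (hu : ∀ i, 0 < u i)
    (hBu : ∀ i, 0 < (B.map (Int.cast : ℤ → ℝ)).mulVec u i) : IsFiniteType B := by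
  have hexp : ∀ (v : κ → ℝ) i, (B.map (Int.cast : ℤ → ℝ)).mulVec v i = ∑ j, (B i j : ℝ) * v j :=
    fun v i => rfl
  have hoff : ∀ i j, i ≠ j → (B i j : ℝ) ≤ 0 := fun i j h => by exact_mod_cast hB.nonpos i j h
  have hnonneg : ∀ v : κ → ℝ, (∀ i, 0 ≤ (B.map (Int.cast : ℤ → ℝ)).mulVec v i) → ∀ i, 0 ≤ v i := by
    intro v hv i₀
    obtain ⟨i, -, hi⟩ := Finset.univ.exists_min_image (fun i => v i / u i) ⟨i₀, Finset.mem_univ _⟩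
    have key : ∀ j, v i / u i * u j ≤ v j := fun j => by
      have := hi j (Finset.mem_univ j)
      rwa [le_div_iff₀ (hu j)] at this
    by_cases hm : 0 ≤ v i / u i
    · exact le_trans (mul_nonneg hm (hu i₀).le) (key i₀)
    · exfalso
      have h1 : (B.map (Int.cast : ℤ → ℝ)).mulVec v i ≤
          v i / u i * (B.map (Int.cast : ℤ → ℝ)).mulVec u i := by
        rw [hexp, hexp, Finset.mul_sum]
        refine Finset.sum_le_sum fun j _ => ?_
        by_cases hij : i = j
        · subst hij
          have := (hu i).ne'
          apply le_of_eq
          field_simp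
        · have := mul_le_mul_of_nonpos_left (key j) (hoff i j hij)
          linarith
      have h2 := mul_neg_of_neg_of_pos (not_le.1 hm) (hBu i)
      linarith [hv i]
  have hinj : ∀ v : κ → ℝ, (B.map (Int.cast : ℤ → ℝ)).mulVec v = 0 → v = 0 := by
    intro v hv
    ext i
    refine le_antisymm ?_ (hnonneg v (fun i => by rw [hv]; exact le_rfl) i)
    have := hnonneg (-v) (fun i => by rw [Matrix.mulVec_neg, hv]; simp) i
    simpa using this
  refine ⟨?_, ⟨u, hu, hBu⟩, fun v hv => ?_⟩
  · intro hdet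
    have hdet' : (B.map (Int.cast : ℤ → ℝ)).det = 0 := by
      have := Int.cast_det (R := ℝ) B
      rw [hdet, Int.cast_zero] at this
      exact this.symm
    obtain ⟨v, hv0, hv⟩ := Matrix.exists_mulVec_eq_zero_iff.2 hdet'
    exact hv0 (hinj v hv)
  · have hv0 := hnonneg v hv
    rw [or_iff_not_imp_left]
    intro hpos
    push Not at hpos
    obtain ⟨i, hi⟩ := hpos
    ext j
    induction hconn i j with
    | refl => exact le_antisymm hi (hv0 i)
    | @tail a b _ hab ih =>
      simp only [Pi.zero_apply] at ih ⊢
      by_cases hba : a = b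
      · rw [← hba, ih]
      have h1 := hv a
      rw [hexp] at h1
      have hterm : ∀ k ∈ Finset.univ, (B a k : ℝ) * v k ≤ 0 := fun k _ => by
        by_cases hk : a = k
        · rw [← hk, ih, mul_zero]
        · exact mul_nonpos_of_nonpos_of_nonneg (hoff a k hk) (hv0 k)
      have h2 := (Finset.sum_eq_zero_iff_of_nonpos hterm).1
        (le_antisymm (Finset.sum_nonpos hterm) h1) b (Finset.mem_univ b)
      rcases mul_eq_zero.1 h2 with h | h
      · exact absurd (by exact_mod_cast h) hab
      · exact h

/-- An indecomposable generalized Cartan matrix that is not of finite type has a positive left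
vector `f` with `f B ≤ 0`. -/
theorem IsGCM.exists_pos_vecMul_nonpos (hB : IsGCM B)
    (hconn : ∀ i j, Relation.ReflTransGen (fun a b => B a b ≠ 0) i j) (hfin : ¬ IsFiniteType B) :
    ∃ f : κ → ℝ, (∀ i, 0 < f i) ∧ ∀ j, ∑ i, f i * (B i j : ℝ) ≤ 0 := by
  have hoff : ∀ i j, i ≠ j → (B i j : ℝ) ≤ 0 := fun i j h => by exact_mod_cast hB.nonpos i j h
  have hdiag : ∀ i, (B i i : ℝ) = 2 := fun i => by rw [hB.diag]; norm_num
  rcases (B.map (Int.cast : ℤ → ℝ)).exists_one_le_or_exists_nonpos with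
    ⟨u, hu, hBu⟩ | ⟨f, hf, hf0, hfB⟩
  · exfalso
    refine hfin (hB.isFiniteType_of_pos hconn (u := u) (fun i => ?_)
      fun i => one_pos.trans_le (hBu i))
    refine lt_of_le_of_ne (hu i) fun h => ?_
    have h1 := hBu i
    have h2 : (B.map (Int.cast : ℤ → ℝ)).mulVec u i ≤ 0 := by
      refine Finset.sum_nonpos fun j _ => ?_
      by_cases hij : i = j
      · rw [← hij, ← h, mul_zero]
      · exact mul_nonpos_of_nonpos_of_nonneg (hoff i j hij) (hu j)
    linarith
  · let P : Finset κ → Prop := fun S => ∃ f : κ → ℝ, (∀ i, 0 ≤ f i) ∧ (∀ i ∈ S, 0 < f i) ∧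
      ∀ j, ∑ i, f i * (B i j : ℝ) ≤ 0
    obtain ⟨i₀, hi₀⟩ : ∃ i, f i ≠ 0 := by
      by_contra! h
      exact hf0 (funext h)
    have hP0 : P {i₀} := ⟨f, hf, fun i hi => by
      rw [Finset.mem_singleton.1 hi]
      exact lt_of_le_of_ne (hf i₀) hi₀.symm, hfB⟩
    -- The support can be enlarged to a neighbour b: if f_b = 0, column b of fB is strictly
    -- negative, which leaves room for a small entry ε at b. It costs 2ε in column b and only lowers
    -- the other columns.
    have hstep : ∀ S, P S → ∀ a ∈ S, ∀ b, B a b ≠ 0 → P (insert b S) := by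
      rintro S ⟨f, hf, hfS, hfB⟩ a ha b hab
      by_cases hb : 0 < f b
      · refine ⟨f, hf, fun i hi => ?_, hfB⟩
        rcases Finset.mem_insert.1 hi with rfl | hi
        · exact hb
        · exact hfS i hi
      have hb0 : f b = 0 := le_antisymm (not_lt.1 hb) (hf b)
      have hne : a ≠ b := by rintro rfl; exact hb (hfS a ha)
      have hlt : ∑ i, f i * (B i b : ℝ) < 0 := by
        have hterm : ∀ k ∈ Finset.univ, f k * (B k b : ℝ) ≤ 0 := fun k _ => by
          by_cases hk : k = b
          · rw [hk, hb0, zero_mul]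
          · exact mul_nonpos_of_nonneg_of_nonpos (hf k) (hoff k b hk)
        refine Finset.sum_neg' hterm ⟨a, Finset.mem_univ a, ?_⟩
        refine mul_neg_of_pos_of_neg (hfS a ha) (lt_of_le_of_ne (hoff a b hne) ?_)
        exact_mod_cast hab
      obtain ⟨ε, hε, hεb⟩ : ∃ ε : ℝ, 0 < ε ∧ ∑ i, f i * (B i b : ℝ) + ε * 2 ≤ 0 :=
        ⟨-(∑ i, f i * (B i b : ℝ)) / 2, by linarith, by linarith⟩
      refine ⟨f + Pi.single b ε, fun i => ?_, fun i hi => ?_, fun j => ?_⟩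
      · rw [Pi.add_apply]
        refine add_nonneg (hf i) ?_
        by_cases h : i = b
        · subst h; simp [hε.le]
        · simp [h]
      · rw [Pi.add_apply]
        by_cases h : i = b
        · subst h; simpa [hb0] using hε
        · rw [Pi.single_eq_of_ne h, add_zero]
          exact hfS i ((Finset.mem_insert.1 hi).resolve_left h)
      · simp only [Pi.add_apply, add_mul, Finset.sum_add_distrib]
        have : ∑ i, (Pi.single b ε : κ → ℝ) i * (B i j : ℝ) = ε * B b j := by
          rw [Finset.sum_eq_single b]
          · simp
          · intro i _ hi; simp [hi]
          · simp
        rw [this]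
        by_cases h : b = j
        · subst h; rw [hdiag]; exact hεb
        · have := mul_nonpos_of_nonneg_of_nonpos hε.le (hoff b j h)
          linarith [hfB j]
    have hall : ∀ T : Finset κ, ∃ S, P S ∧ i₀ ∈ S ∧ T ⊆ S := by
      have hone : ∀ j S, P S → i₀ ∈ S → ∃ S', P S' ∧ S ⊆ S' ∧ j ∈ S' := by
        intro j S hS hi
        induction hconn i₀ j with
        | refl => exact ⟨S, hS, subset_rfl, hi⟩
        | tail _ hab ih =>
          obtain ⟨S', h1, h2, h3⟩ := ih
          exact ⟨_, hstep S' h1 _ h3 _ hab, h2.trans (Finset.subset_insert _ _),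
            Finset.mem_insert_self _ _⟩
      intro T
      induction T using Finset.induction_on with
      | empty => exact ⟨_, hP0, Finset.mem_singleton_self _, Finset.empty_subset _⟩
      | insert j T _ ih =>
        obtain ⟨S, h1, h2, h3⟩ := ih
        obtain ⟨S', h4, h5, h6⟩ := hone j S h1 h2
        exact ⟨S', h4, h5 h2, Finset.insert_subset h6 (h3.trans h5)⟩
    obtain ⟨S, ⟨f, -, hf, hfB⟩, -, hS⟩ := hall Finset.univ
    exact ⟨f, fun i => hf i (hS (Finset.mem_univ i)), hfB⟩

end Matrices

noncomputable section

/-! ### Components of subdiagrams -/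

section Components

variable {ι : Type*} {A : Matrix ι ι ℤ}

theorem IsGCM.submatrix_val (hA : IsGCM A) (K : Set ι) :
    IsGCM (A.submatrix (Subtype.val : K → ι) (Subtype.val : K → ι)) where
  diag i := hA.diag i
  nonpos i j h := hA.nonpos i j fun h' => h (Subtype.ext h')
  zero_symm i j h := hA.zero_symm i j h

theorem IsGCM.symm_ne (hA : IsGCM A) {i j : ι} (h : A i j ≠ 0) : A j i ≠ 0 :=
  fun h' => h (hA.zero_symm j i h')

theorem IsGCM.cast_nonpos (hA : IsGCM A) {i j : ι} (h : i ≠ j) : (A i j : ℝ) ≤ 0 := by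
  exact_mod_cast hA.nonpos i j h

theorem self_mem_dynkinComponent (Θ : Set ι) (i : ι) : i ∈ dynkinComponent A Θ i :=
  Relation.ReflTransGen.refl

theorem dynkinComponent_subset {Θ : Set ι} {i : ι} (hi : i ∈ Θ) : dynkinComponent A Θ i ⊆ Θ := by
  intro j hj
  cases Relation.ReflTransGen.cases_tail hj with
  | inl h => rwa [h]
  | inr h =>
    obtain ⟨k, -, -, h, -⟩ := h
    exact h

theorem mem_dynkinComponent_of_ne {Θ : Set ι} {i a b : ι} (ha : a ∈ dynkinComponent A Θ i)
    (haΘ : a ∈ Θ) (hb : b ∈ Θ) (hab : A a b ≠ 0) : b ∈ dynkinComponent A Θ i :=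
  Relation.ReflTransGen.tail ha ⟨haΘ, hb, hab⟩

theorem IsGCM.mem_dynkinComponent_symm (hA : IsGCM A) {Θ : Set ι} {i j : ι}
    (h : j ∈ dynkinComponent A Θ i) : i ∈ dynkinComponent A Θ j := by
  have : Std.Symm (fun a b => a ∈ Θ ∧ b ∈ Θ ∧ A a b ≠ 0) :=
    ⟨fun _ _ hab => ⟨hab.2.1, hab.1, hA.symm_ne hab.2.2⟩⟩
  exact (Relation.ReflTransGen.stdSymm (r := fun a b => a ∈ Θ ∧ b ∈ Θ ∧ A a b ≠ 0)).symm _ _ h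

theorem IsGCM.dynkinComponent_eq (hA : IsGCM A) {Θ : Set ι} {i j : ι}
    (h : j ∈ dynkinComponent A Θ i) : dynkinComponent A Θ j = dynkinComponent A Θ i :=
  Set.ext fun _ => ⟨fun hk => Relation.ReflTransGen.trans h hk,
    fun hk => Relation.ReflTransGen.trans (hA.mem_dynkinComponent_symm h) hk⟩

theorem IsGCM.dynkinComponent_connected (hA : IsGCM A) {Θ : Set ι} {i : ι}
    (a b : dynkinComponent A Θ i) :
    Relation.ReflTransGen (fun a b => A.submatrix (Subtype.val : dynkinComponent A Θ i → ι)
      (Subtype.val : dynkinComponent A Θ i → ι) a b ≠ 0) a b := by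
  have key : ∀ c (hc : c ∈ dynkinComponent A Θ i),
      Relation.ReflTransGen (fun a b => A.submatrix (Subtype.val : dynkinComponent A Θ i → ι)
      (Subtype.val : dynkinComponent A Θ i → ι) a b ≠ 0)
      ⟨i, self_mem_dynkinComponent Θ i⟩ ⟨c, hc⟩ := by
    intro c hc
    induction hc with
    | refl => exact Relation.ReflTransGen.refl
    | tail h1 h2 ih => exact ih.tail h2.2.2
  have : Std.Symm (fun a b => A.submatrix (Subtype.val : dynkinComponent A Θ i → ι)
      (Subtype.val : dynkinComponent A Θ i → ι) a b ≠ 0) := ⟨fun _ _ hab => hA.symm_ne hab⟩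
  exact Relation.ReflTransGen.trans
    (Relation.ReflTransGen.stdSymm.symm _ _ (key a a.2)) (key b b.2)

variable [Fintype ι]

theorem infinitePart_subset (J : Set ι) : infinitePart A J ⊆ J := fun _ h => h.1

theorem IsGCM.mem_infinitePart_of_mem (hA : IsGCM A) {J : Set ι} {i j : ι}
    (hi : i ∈ infinitePart A J) (hj : j ∈ dynkinComponent A J i) : j ∈ infinitePart A J :=
  ⟨dynkinComponent_subset hi.1 hj, by rw [hA.dynkinComponent_eq hj]; exact hi.2⟩

theorem IsGCM.dynkinComponent_infinitePart (hA : IsGCM A) {J : Set ι} {i : ι}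
    (hi : i ∈ infinitePart A J) :
    dynkinComponent A (infinitePart A J) i = dynkinComponent A J i := by
  ext j
  constructor
  · intro h
    induction h with
    | refl => exact self_mem_dynkinComponent _ _
    | tail h1 h2 ih => exact ih.tail ⟨h2.1.1, h2.2.1.1, h2.2.2⟩
  · intro h
    induction h with
    | refl => exact self_mem_dynkinComponent _ _
    | tail h1 h2 ih =>
      exact ih.tail ⟨hA.mem_infinitePart_of_mem hi h1,
        hA.mem_infinitePart_of_mem hi (h1.tail h2), h2.2.2⟩

theorem IsGCM.isSpecial_infinitePart (hA : IsGCM A) (J : Set ι) :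
    IsSpecial A (infinitePart A J) := by
  ext i
  constructor
  · exact fun hi => ⟨hi, by rw [hA.dynkinComponent_infinitePart hi]; exact hi.2⟩
  · exact fun hi => hi.1

theorem IsGCM.dynkinComponent_subset_diff (hA : IsGCM A) {J : Set ι} {i : ι}
    (hi : i ∈ J \ infinitePart A J) : dynkinComponent A J i ⊆ J \ infinitePart A J :=
  fun _ hj => ⟨dynkinComponent_subset hi.1 hj, fun h =>
    hi.2 (hA.mem_infinitePart_of_mem h (hA.mem_dynkinComponent_symm hj))⟩

theorem IsGCM.eq_zero_of_mem_infinitePart (hA : IsGCM A) {J : Set ι} {i k : ι}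
    (hi : i ∈ J \ infinitePart A J) (hk : k ∈ infinitePart A J) : A i k = 0 := by
  by_contra h
  exact (hA.dynkinComponent_subset_diff hi
    (mem_dynkinComponent_of_ne (self_mem_dynkinComponent J i) hi.1 hk.1 h)).2 hk

/-- A special set carries a positive antidominant combination of simple coroots. -/
theorem IsGCM.exists_pos_of_isSpecial (hA : IsGCM A) {Θ : Set ι} (hΘ : IsSpecial A Θ) :
    ∃ f : ι → ℝ, (∀ i ∈ Θ, 0 < f i) ∧ (∀ i, i ∉ Θ → f i = 0) ∧
      ∀ j, ∑ i, f i * (A i j : ℝ) ≤ 0 := by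
  classical
  have hcomp : ∀ i : ι, ∃ f : ι → ℝ, (∀ k, 0 ≤ f k) ∧ (i ∈ Θ → 0 < f i) ∧
      (∀ k, k ∉ Θ → f k = 0) ∧ ∀ j, ∑ k, f k * (A k j : ℝ) ≤ 0 := by
    intro i
    by_cases hi : i ∈ Θ
    · have hfin : ¬ IsFiniteTypeOn A (dynkinComponent A Θ i) := by
        have : i ∈ infinitePart A Θ := hΘ ▸ hi
        exact this.2
      obtain ⟨f, hf, hfA⟩ := (hA.submatrix_val _).exists_pos_vecMul_nonpos
        hA.dynkinComponent_connected hfin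
      -- Extending by zero is harmless: a column outside the component meets no diagonal entry, so
      -- its sum is nonpositive.
      let F : ι → ℝ := fun k => if hk : k ∈ dynkinComponent A Θ i then f ⟨k, hk⟩ else 0
      have hF0 : ∀ k, 0 ≤ F k := fun k => by
        by_cases hk : k ∈ dynkinComponent A Θ i
        · simp only [F, dif_pos hk]; exact (hf _).le
        · simp only [F, dif_neg hk]; exact le_rfl
      have hFn : ∀ k, k ∉ dynkinComponent A Θ i → F k = 0 := fun k hk => by
        simp only [F, dif_neg hk]
      refine ⟨F, hF0, fun _ => ?_, fun k hk => hFn k fun h => hk (dynkinComponent_subset hi h),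
        fun j => ?_⟩
      · have := self_mem_dynkinComponent (A := A) Θ i
        simp only [F, dif_pos this]; exact hf _
      · by_cases hj : j ∈ dynkinComponent A Θ i
        · have h1 := hfA ⟨j, hj⟩
          refine le_trans (le_of_eq ?_) h1
          rw [← Finset.sum_subset (Finset.subset_univ
            (Finset.univ.filter (· ∈ dynkinComponent A Θ i)))]
          · rw [Finset.sum_subtype (p := (· ∈ dynkinComponent A Θ i)) _ (by simp)]
            refine Finset.sum_congr rfl fun k _ => ?_
            simp only [F, dif_pos k.2, Matrix.submatrix_apply]
          · intro k _ hk
            rw [hFn k (by simpa using hk), zero_mul]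
        · refine Finset.sum_nonpos fun k _ => ?_
          by_cases hk : k = j
          · rw [hk, hFn j hj, zero_mul]
          · exact mul_nonpos_of_nonneg_of_nonpos (hF0 k) (hA.cast_nonpos hk)
    · exact ⟨0, fun _ => le_rfl, fun h => absurd h hi, fun _ _ => rfl, fun j => by simp⟩
  choose f hf0 hfpos hfn hfA using hcomp
  refine ⟨fun k => ∑ i, f i k, fun i hi => ?_, fun k hk => ?_, fun j => ?_⟩
  · exact Finset.sum_pos' (fun k _ => hf0 k i) ⟨i, Finset.mem_univ i, hfpos i hi⟩
  · exact Finset.sum_eq_zero fun i _ => hfn i k hk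
  · simp only [Finset.sum_mul]
    rw [Finset.sum_comm]
    exact Finset.sum_nonpos fun i _ => hfA i j

end Components

namespace FreeRealization

variable {ι : Type*} {A : Matrix ι ι ℤ} {V : Type*} [AddCommGroup V] [Module ℝ V]
  (D : FreeRealization A V)

/-! ### The Tits cone in finite type -/

section FiniteType

variable [Fintype ι]

theorem sum_coroot_simple_smul [DecidableEq ι] (c : ι → ℝ) (j : ι) (v : V) :
    ∑ i, c i * D.coroot i (D.simple j • v) =
      ∑ i, (c - Pi.single j (∑ k, c k * (A k j : ℝ)) : ι → ℝ) i * D.coroot i v := by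
  simp only [simple_smul, map_sub, map_smul, D.coroot_root, Pi.sub_apply, sub_mul, smul_eq_mul,
    mul_sub, Finset.sum_sub_distrib]
  congr 1
  rw [Finset.sum_eq_single j (f := fun i => (Pi.single j _ : ι → ℝ) i * D.coroot i v)]
  · rw [Pi.single_eq_same, Finset.sum_mul]
    exact Finset.sum_congr rfl fun i _ => by ring
  · intro i _ hi
    rw [Pi.single_eq_of_ne hi, zero_mul]
  · simp

/-- Coefficient vectors of the combinations of coroots that are nonnegative on the Tits cone. -/
def dualCone : PointedCone ℝ (ι → ℝ) where
  carrier := {c | ∀ v ∈ D.titsCone, 0 ≤ ∑ i, c i * D.coroot i v}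
  zero_mem' := fun v _ => by simp
  add_mem' := fun {c c'} h h' v hv => by
    simp only [Pi.add_apply, add_mul, Finset.sum_add_distrib]
    exact add_nonneg (h v hv) (h' v hv)
  smul_mem' := by
    rintro ⟨r, hr⟩ c h v hv
    have : ∑ i, (r • c) i * D.coroot i v = r * ∑ i, c i * D.coroot i v := by
      simp [Finset.mul_sum, mul_assoc]
    change 0 ≤ ∑ i, (r • c) i * D.coroot i v
    rw [this]
    exact mul_nonneg hr (h v hv)

/-- Evaluate at a fundamental weight, which lies in the closed chamber. -/
theorem nonneg_of_mem_dualCone {c : ι → ℝ} (hc : c ∈ D.dualCone) (i : ι) : 0 ≤ c i := by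
  classical
  obtain ⟨v, hv⟩ := D.exists_coroot_eq (Pi.single i 1)
  have := hc v (D.closedChamber_subset_titsCone fun k => by
    rw [hv]
    by_cases h : k = i
    · subst h; simp
    · simp [h])
  simpa [hv, Pi.single_apply] using this

theorem reflect_mem_dualCone [DecidableEq ι] {c : ι → ℝ} (hc : c ∈ D.dualCone) (j : ι) :
    c - Pi.single j (∑ k, c k * (A k j : ℝ)) ∈ D.dualCone := by
  intro v hv
  rw [← D.sum_coroot_simple_smul]
  exact hc _ (D.smul_mem_titsCone _ hv)

/-- Let h_i(ρ) = 1 for all i. Every vector enters the chamber after adding a multiple of ρ, so -ρ ∈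
X would give X = V. Otherwise there is a form nonnegative on X and equal to 1 at ρ. It vanishes
where all coroots vanish, since that subspace lies in X, and so it is a combination of coroots. -/
theorem exists_ne_zero_mem_dualCone (h : D.titsCone ≠ Set.univ) : ∃ c ∈ D.dualCone, c ≠ 0 := by
  classical
  obtain ⟨ρ, hρ⟩ := D.exists_coroot_eq fun _ => 1
  have hshift : ∀ y : V, ∃ t : ℝ, 0 ≤ t ∧ t • ρ + y ∈ D.titsCone := by
    intro y
    refine ⟨∑ i, |D.coroot i y|, Finset.sum_nonneg fun i _ => abs_nonneg _,
      D.closedChamber_subset_titsCone fun i => ?_⟩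
    have h1 := Finset.single_le_sum (f := fun i => |D.coroot i y|) (fun i _ => abs_nonneg _)
      (Finset.mem_univ i)
    have h2 := neg_abs_le (D.coroot i y)
    rw [map_add, map_smul, hρ, smul_eq_mul, mul_one]
    linarith
  have hneg : -ρ ∉ D.titsConvexCone := by
    rw [mem_titsConvexCone]
    intro hρX
    refine h (Set.eq_univ_of_forall fun y => ?_)
    obtain ⟨t, ht, hty⟩ := hshift y
    have := D.add_mem_titsCone hty (D.real_smul_mem_titsCone ht hρX)
    convert this using 1
    module
  obtain ⟨g, hg1, hg⟩ := D.titsConvexCone.exists_nonneg_functional hneg fun y => by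
    obtain ⟨t, -, ht⟩ := hshift y
    exact ⟨t, D.mem_titsConvexCone.2 ht⟩
  have hker : ∀ v, (∀ i, D.coroot i v = 0) → g v = 0 := by
    intro v hv
    have h1 := hg v (D.mem_titsConvexCone.2 (D.closedChamber_subset_titsCone
      fun i => (hv i).ge))
    have h2 := hg (-v) (D.mem_titsConvexCone.2 (D.closedChamber_subset_titsCone
      fun i => by rw [map_neg, hv i, neg_zero]))
    rw [map_neg] at h2
    linarith
  choose ω hω using fun i : ι => D.exists_coroot_eq (Pi.single i 1)
  have hgω : ∀ v, g v = ∑ i, g (ω i) * D.coroot i v := by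
    intro v
    have := hker (v - ∑ i, D.coroot i v • ω i) fun k => by
      simp [map_sub, map_sum, hω, Pi.single_apply]
    rw [map_sub, map_sum, sub_eq_zero] at this
    rw [this]
    exact Finset.sum_congr rfl fun i _ => by rw [map_smul, smul_eq_mul, mul_comm]
  refine ⟨fun i => g (ω i), fun v hv => ?_, fun h0 => ?_⟩
  · rw [← hgω]
    exact hg v (D.mem_titsConvexCone.2 hv)
  · rw [hgω] at hg1
    simp only [funext_iff, Pi.zero_apply] at h0
    simp [h0] at hg1

/-- The span is stable under reflections, so it contains the unit vector e_j as soon as it contains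
some c with (cA)_j ≠ 0. Since det A ≠ 0 there is a first such j, and connectedness reaches the
others. -/
theorem span_dualCone_eq_top [DecidableEq ι] (hdet : A.det ≠ 0)
    (hconn : ∀ i j, Relation.ReflTransGen (fun a b => A a b ≠ 0) i j)
    (h : D.titsCone ≠ Set.univ) : Submodule.span ℝ (D.dualCone : Set (ι → ℝ)) = ⊤ := by
  have hrefl : ∀ c ∈ Submodule.span ℝ (D.dualCone : Set (ι → ℝ)), ∀ j,
      Pi.single j (∑ k, c k * (A k j : ℝ)) ∈ Submodule.span ℝ (D.dualCone : Set (ι → ℝ)) := by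
    intro c hc j
    induction hc using Submodule.span_induction with
    | mem c hc =>
      have := Submodule.sub_mem _ (Submodule.subset_span hc)
        (Submodule.subset_span (R := ℝ) (D.reflect_mem_dualCone hc j))
      rwa [sub_sub_cancel] at this
    | zero => simp
    | add c c' _ _ hc hc' =>
      have := Submodule.add_mem _ hc hc'
      rw [← Pi.single_add, ← Finset.sum_add_distrib] at this
      simpa only [Pi.add_apply, add_mul] using this
    | smul a c _ hc =>
      have := Submodule.smul_mem _ a hc
      rw [← Pi.single_smul, Finset.smul_sum] at this
      simpa only [Pi.smul_apply, smul_eq_mul, mul_assoc] using this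
  have hunit : ∀ c ∈ Submodule.span ℝ (D.dualCone : Set (ι → ℝ)), ∀ j,
      ∑ k, c k * (A k j : ℝ) ≠ 0 →
      Pi.single j 1 ∈ Submodule.span ℝ (D.dualCone : Set (ι → ℝ)) := by
    intro c hc j hj
    have := Submodule.smul_mem _ (∑ k, c k * (A k j : ℝ))⁻¹ (hrefl c hc j)
    rwa [← Pi.single_smul, smul_eq_mul, inv_mul_cancel₀ hj] at this
  obtain ⟨c, hc, hc0⟩ := D.exists_ne_zero_mem_dualCone h
  obtain ⟨j, hj⟩ : ∃ j, ∑ k, c k * (A k j : ℝ) ≠ 0 := by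
    by_contra! h0
    refine hdet ?_
    have : (A.map (Int.cast : ℤ → ℝ)).det = 0 :=
      Matrix.exists_vecMul_eq_zero_iff.1 ⟨c, hc0, funext h0⟩
    have h1 := Int.cast_det (R := ℝ) A
    rw [this] at h1
    exact_mod_cast h1
  have hall : ∀ k, Pi.single k 1 ∈ Submodule.span ℝ (D.dualCone : Set (ι → ℝ)) := by
    intro k
    induction hconn j k with
    | refl => exact hunit c (Submodule.subset_span hc) j hj
    | @tail a b _ hab ih =>
      refine hunit _ ih b ?_
      rw [Finset.sum_eq_single a]
      · rw [Pi.single_eq_same, one_mul]; exact_mod_cast hab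
      · intro i _ hi; rw [Pi.single_eq_of_ne hi, zero_mul]
      · simp
  rw [eq_top_iff]
  intro c _
  rw [← Finset.univ_sum_single c]
  refine Submodule.sum_mem _ fun i _ => ?_
  have := Submodule.smul_mem _ (c i) (hall i)
  rwa [← Pi.single_smul, smul_eq_mul, mul_one] at this

/-- A convex cone with full span has interior points; choose a nonzero rational one and clear
denominators. Integrality supports the descent that proves `titsCone_eq_univ`. -/
theorem exists_int_mem_dualCone [DecidableEq ι] (hdet : A.det ≠ 0)
    (hconn : ∀ i j, Relation.ReflTransGen (fun a b => A a b ≠ 0) i j)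
    (h : D.titsCone ≠ Set.univ) :
    ∃ n : ι → ℤ, n ≠ 0 ∧ (fun i => (n i : ℝ)) ∈ D.dualCone := by
  have hint : (interior (D.dualCone : Set (ι → ℝ))).Nonempty := by
    rw [D.dualCone.convex.interior_nonempty_iff_affineSpan_eq_top]
    apply SetLike.coe_injective
    have h0 : insert 0 (D.dualCone : Set (ι → ℝ)) = D.dualCone :=
      Set.insert_eq_of_mem D.dualCone.zero_mem
    rw [← h0, affineSpan_insert_zero, D.span_dualCone_eq_top hdet hconn h]
    rfl
  obtain ⟨c, -, hc0⟩ := D.exists_ne_zero_mem_dualCone h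
  have : Nontrivial (ι → ℝ) := ⟨c, 0, hc0⟩
  have : (nhdsWithin (0 : ι → ℝ) {0}ᶜ).NeBot := Module.punctured_nhds_neBot ℝ (ι → ℝ) 0
  have hint' := (dense_compl_singleton (0 : ι → ℝ)).inter_open_nonempty _ isOpen_interior hint
  have hdense : DenseRange (Pi.map fun (_ : ι) (q : ℚ) => (q : ℝ)) :=
    DenseRange.piMap fun _ => Rat.denseRange_cast
  obtain ⟨q, hq, hq0⟩ :=
    hdense.exists_mem_open (isOpen_interior.inter isOpen_compl_singleton) hint'
  have hqZ := interior_subset hq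
  have hN : ∀ i, ∃ m : ℤ, (m : ℝ) = (∏ k, (q k).den : ℕ) * (q i : ℝ) := by
    intro i
    obtain ⟨d, hd⟩ := Finset.dvd_prod_of_mem (fun k => (q k).den) (Finset.mem_univ i)
    refine ⟨d * (q i).num, ?_⟩
    rw [hd]
    have := (q i).den_mul_eq_num
    have h2 : ((q i).den : ℝ) * (q i : ℝ) = (q i).num := by exact_mod_cast this
    push_cast
    linear_combination (-(d : ℝ)) * h2
  choose n hn using hN
  have hNpos : (0 : ℝ) < (∏ k, (q k).den : ℕ) := by
    exact_mod_cast Finset.prod_pos fun k _ => (q k).den_pos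
  have heq : (fun i => (n i : ℝ)) =
      ((∏ k, (q k).den : ℕ) : ℝ) • (Pi.map (fun (_ : ι) (q : ℚ) => (q : ℝ)) q) :=
    funext hn
  refine ⟨n, fun hn0 => hq0 ?_, ?_⟩
  · rw [hn0] at heq
    have h0 : ((∏ k, (q k).den : ℕ) : ℝ) • (Pi.map (fun (_ : ι) (q : ℚ) => (q : ℝ)) q) = 0 := by
      rw [← heq]; ext i; simp
    exact (smul_eq_zero.1 h0).resolve_left hNpos.ne'
  · rw [heq]
    exact PointedCone.smul_mem _ hNpos.le hqZ

/-- Otherwise choose a nonzero integral vector n of the dual cone with least coordinate sum.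
Reflection in j lowers this sum by (nA)_j, so nA ≤ 0. Pairing with u > 0, Au > 0 gives nAu ≤ 0,
while n ≥ 0, n ≠ 0 gives nAu > 0. -/
theorem titsCone_eq_univ [DecidableEq ι] (hA : IsFiniteType A)
    (hconn : ∀ i j, Relation.ReflTransGen (fun a b => A a b ≠ 0) i j) :
    D.titsCone = Set.univ := by
  by_contra h
  obtain ⟨hdet, ⟨u, hu, hAu⟩, -⟩ := hA
  let S : Set (ι → ℤ) := {n | n ≠ 0 ∧ (fun i => (n i : ℝ)) ∈ D.dualCone}
  have hS : S.Nonempty := D.exists_int_mem_dualCone hdet hconn h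
  obtain ⟨n, ⟨hn0, hn⟩, hmin⟩ := (measure fun n : ι → ℤ => (∑ i, n i).toNat).wf.has_min S hS
  have hnn : ∀ n ∈ S, ∀ i, 0 ≤ n i := fun n hn i => by
    exact_mod_cast D.nonneg_of_mem_dualCone hn.2 i
  have hm : ∀ j, ∑ k, n k * A k j ≤ 0 := by
    intro j
    obtain ⟨m, hm⟩ : ∃ m, m = ∑ k, n k * A k j := ⟨_, rfl⟩
    rw [← hm]
    -- The reflected vector is nonzero: n = m·e_j would give m = (nA)_j = 2m.
    have hmem : n - Pi.single j m ∈ S := by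
      constructor
      · intro h0
        have hnj : n = Pi.single j m := sub_eq_zero.1 h0
        have : m = 2 * m := by
          conv_lhs => rw [hm, hnj]
          rw [Finset.sum_eq_single j]
          · rw [Pi.single_eq_same, D.isGCM.diag]; ring
          · intro i _ hi; rw [Pi.single_eq_of_ne hi, zero_mul]
          · simp
        have hm0 : m = 0 := by omega
        rw [hm0, Pi.single_zero] at hnj
        exact hn0 hnj
      · have := D.reflect_mem_dualCone hn j
        convert this using 1
        ext i
        simp only [Pi.sub_apply]
        by_cases hi : i = j
        · subst hi
          simp [hm]
        · simp [hi]
    have h1 := hmin _ hmem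
    have h2 := Finset.sum_nonneg fun i (_ : i ∈ Finset.univ) => hnn _ hmem i
    have h3 := Finset.sum_nonneg fun i (_ : i ∈ Finset.univ) => hnn n ⟨hn0, hn⟩ i
    change ¬ (∑ i, (n - Pi.single j m : ι → ℤ) i).toNat < (∑ i, n i).toNat at h1
    have h4 : ∑ i, (n - Pi.single j m : ι → ℤ) i = ∑ i, n i - m := by
      simp [Finset.sum_sub_distrib]
    rw [h4] at h1 h2
    omega
  have h1 : ∑ j, (∑ k, (n k : ℝ) * A k j) * u j ≤ 0 := by
    refine Finset.sum_nonpos fun j _ => mul_nonpos_of_nonpos_of_nonneg ?_ (hu j).le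
    exact_mod_cast hm j
  have h2 : ∑ j, (∑ k, (n k : ℝ) * A k j) * u j =
      ∑ k, (n k : ℝ) * (A.map (Int.cast : ℤ → ℝ)).mulVec u k := by
    simp only [Finset.sum_mul, Matrix.mulVec, dotProduct, Finset.mul_sum, Matrix.map_apply]
    rw [Finset.sum_comm]
    simp only [mul_assoc]
  have h3 : 0 < ∑ k, (n k : ℝ) * (A.map (Int.cast : ℤ → ℝ)).mulVec u k := by
    obtain ⟨i, hi⟩ : ∃ i, n i ≠ 0 := by
      by_contra! h0
      exact hn0 (funext h0)
    have hnR : ∀ k, (0 : ℝ) ≤ n k := fun k => D.nonneg_of_mem_dualCone hn k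
    refine Finset.sum_pos' (fun k _ => mul_nonneg (hnR k) (hAu k).le) ⟨i, Finset.mem_univ i, ?_⟩
    refine mul_pos (lt_of_le_of_ne (hnR i) ?_) (hAu i)
    exact_mod_cast hi.symm
  linarith

end FiniteType

/-! ### Restriction to a subset of the simple roots -/

/-- The free realization of a principal submatrix. -/
def restrict (K : Set ι) :
    FreeRealization (A.submatrix (Subtype.val : K → ι) (Subtype.val : K → ι)) V where
  isGCM := D.isGCM.submatrix_val K
  root i := D.root i
  coroot i := D.coroot i
  linearIndependent_root := D.linearIndependent_root.comp _ Subtype.val_injective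
  linearIndependent_coroot := D.linearIndependent_coroot.comp _ Subtype.val_injective
  coroot_root i j := D.coroot_root i j

theorem exists_mem_parabolic_of_restrict {K : Set ι} (w : (D.restrict K).weylGroup) :
    ∃ w' ∈ D.parabolic K, ∀ v : V, w • v = w' • v := by
  induction w using (D.restrict K).weyl_induction with
  | one => exact ⟨1, one_mem _, fun v => by rw [one_smul, one_smul]⟩
  | simple_mul i w ih =>
    obtain ⟨w', hw', h⟩ := ih
    refine ⟨D.simple i * w', mul_mem (D.simple_mem_parabolic i.2) hw', fun v => ?_⟩
    rw [mul_smul, mul_smul, h, simple_smul, simple_smul]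
    rfl

variable [Fintype ι]

/-- The realization restricted to the component lives on the same V, and its Tits cone is all of V
by finite type. -/
theorem exists_dominant_of_component {Θ : Set ι} {i : ι}
    (hfin : IsFiniteTypeOn A (dynkinComponent A Θ i)) (v : V) :
    ∃ w ∈ D.parabolic (dynkinComponent A Θ i),
      ∀ k ∈ dynkinComponent A Θ i, 0 ≤ D.coroot k (w • v) := by
  classical
  have huniv := (D.restrict (dynkinComponent A Θ i)).titsCone_eq_univ hfin
    D.isGCM.dynkinComponent_connected
  obtain ⟨w, u, hu, hv⟩ : v ∈ (D.restrict (dynkinComponent A Θ i)).titsCone :=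
    huniv ▸ Set.mem_univ v
  obtain ⟨w', hw', h⟩ := D.exists_mem_parabolic_of_restrict w
  refine ⟨w'⁻¹, inv_mem hw', fun k hk => ?_⟩
  rw [hv, h, inv_smul_smul]
  exact hu ⟨k, hk⟩

/-- Every vector can be made dominant for the finite part of `J`. -/
theorem exists_dominant (J : Set ι) (v : V) :
    ∃ w ∈ D.parabolic (J \ infinitePart A J),
      ∀ k ∈ J \ infinitePart A J, 0 ≤ D.coroot k (w • v) := by
  classical
  suffices H : ∀ S : Finset ι, (↑S ⊆ J \ infinitePart A J) →
      ∃ w ∈ D.parabolic (J \ infinitePart A J),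
        ∀ s ∈ S, ∀ k ∈ dynkinComponent A J s, 0 ≤ D.coroot k (w • v) by
    obtain ⟨w, hw, h⟩ := H (Set.toFinite (J \ infinitePart A J)).toFinset (by simp)
    exact ⟨w, hw, fun k hk => h k (by simpa using hk) k (self_mem_dynkinComponent J k)⟩
  intro S
  induction S using Finset.induction_on with
  | empty => exact fun _ => ⟨1, one_mem _, by simp⟩
  | insert s S _ ih =>
    intro hS
    rw [Finset.coe_insert, Set.insert_subset_iff] at hS
    obtain ⟨w, hw, h⟩ := ih hS.2
    have hfin : IsFiniteTypeOn A (dynkinComponent A J s) := by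
      by_contra hfin
      exact hS.1.2 ⟨hS.1.1, hfin⟩
    obtain ⟨w', hw', h'⟩ := D.exists_dominant_of_component hfin (w • v)
    refine ⟨w' * w, mul_mem (D.parabolic_mono (D.isGCM.dynkinComponent_subset_diff hS.1) hw') hw,
      fun r hr k hk => ?_⟩
    rw [mul_smul]
    -- Coroots outside the component of s are unchanged by w', so dominance already achieved there
    -- survives.
    by_cases hks : k ∈ dynkinComponent A J s
    · exact h' k hks
    · rcases Finset.mem_insert.1 hr with rfl | hr
      · exact absurd hk hks
      · rw [D.coroot_smul_of_mem_parabolic hw']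
        · exact h r hr k hk
        · intro i hi
          by_contra hne
          exact hks (mem_dynkinComponent_of_ne hi (dynkinComponent_subset hS.1.1 hi)
            (dynkinComponent_subset (hS.2 hr).1 hk) (D.isGCM.symm_ne hne))

end FreeRealization

end

noncomputable section

namespace FreeRealization

variable {ι : Type*} {A : Matrix ι ι ℤ} {V : Type*} [AddCommGroup V] [Module ℝ V]
  (D : FreeRealization A V)

/-! ### Special faces -/

section Special

variable {D} in
theorem coroot_eq_zero_of_mem_specialFace {Θ : Set ι} {v : V} (hv : v ∈ D.specialFace Θ) {i : ι}
    (hi : i ∈ Θ) : D.coroot i v = 0 := by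
  obtain ⟨w, hw, u, hu, rfl⟩ := hv
  rw [D.coroot_smul_of_mem_parabolic hw fun j hj => D.isGCM.zero_symm _ _ (hj i hi)]
  exact hu.1 i hi

theorem specialFace_subset_titsCone (Θ : Set ι) : D.specialFace Θ ⊆ D.titsCone := by
  rintro _ ⟨w, -, u, hu, rfl⟩
  exact D.smul_mem_titsCone w
    (D.closedChamber_subset_titsCone (D.closedFacet_subset_closedChamber Θ hu))

theorem closedFacet_subset_specialFace (Θ : Set ι) : D.closedFacet Θ ⊆ D.specialFace Θ :=
  fun u hu => ⟨1, one_mem _, u, hu, (one_smul _ u).symm⟩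

variable {D} in
-- Take u to be the sum of a finite subset t of R spanning the linear span of R. For μ = ∑ c_b b,
-- the choice ε = 1/(1 + ∑|c_b|) keeps every coefficient 1 - εc_b nonnegative.
theorem Face.exists_relative_interior [FiniteDimensional ℝ V] (R : D.Face) :
    ∃ u ∈ R.carrier, ∀ μ ∈ R.carrier, ∃ ε : ℝ, 0 < ε ∧ u - ε • μ ∈ R.carrier := by
  obtain ⟨t, htR, ht⟩ := Submodule.fg_span_iff_fg_span_finset_subset R.carrier |>.1
    (IsNoetherian.noetherian (Submodule.span ℝ R.carrier))
  refine ⟨∑ b ∈ t, b, R.cone.sum_mem fun b hb => htR hb, fun μ hμ => ?_⟩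
  have hμt : μ ∈ Submodule.span ℝ (t : Set V) := ht ▸ Submodule.subset_span hμ
  obtain ⟨c, -, hc⟩ := Submodule.mem_span_finset.1 hμt
  have hS : 0 ≤ ∑ b ∈ t, |c b| := Finset.sum_nonneg fun b _ => abs_nonneg _
  refine ⟨(1 + ∑ b ∈ t, |c b|)⁻¹, by positivity, ?_⟩
  rw [← hc, Finset.smul_sum, ← Finset.sum_sub_distrib]
  refine R.cone.sum_mem fun b hb => ?_
  have h1 : b - (1 + ∑ b ∈ t, |c b|)⁻¹ • c b • b =
      (1 - (1 + ∑ b ∈ t, |c b|)⁻¹ * c b) • b := by module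
  rw [h1]
  refine PointedCone.smul_mem _ ?_ (htR hb)
  have h2 := Finset.single_le_sum (f := fun b => |c b|) (fun b _ => abs_nonneg _) hb
  have h3 := le_abs_self (c b)
  rw [sub_nonneg, inv_mul_le_iff₀ (by positivity)]
  linarith

variable [Fintype ι]

/-- The linear form with coefficients `f` with respect to the simple coroots. -/
def corootForm (f : ι → ℝ) : Module.Dual ℝ V := ∑ i, f i • D.coroot i

theorem corootForm_apply (f : ι → ℝ) (v : V) : D.corootForm f v = ∑ i, f i * D.coroot i v := by
  simp [corootForm, LinearMap.sum_apply]

theorem corootForm_root (f : ι → ℝ) (j : ι) :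
    D.corootForm f (D.root j) = ∑ i, f i * (A i j : ℝ) := by
  simp [corootForm_apply, D.coroot_root]

/-- Induction on length: wu = σ_j z with z = σ_j wu and h_j(z) ≥ 0, so passing from z to wu changes
the value by -h_j(z)f(α_j) ≥ 0. -/
theorem corootForm_nonneg {f : ι → ℝ} (hf : ∀ i, 0 ≤ f i)
    (hfA : ∀ j, D.corootForm f (D.root j) ≤ 0) {v : V} (hv : v ∈ D.titsCone) :
    0 ≤ D.corootForm f v := by
  obtain ⟨w, u, hu, rfl⟩ := hv
  induction hn : D.length w using Nat.strong_induction_on generalizing w with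
  | _ n ih =>
    subst hn
    by_cases hw : w = 1
    · subst hw
      rw [one_smul, corootForm_apply]
      exact Finset.sum_nonneg fun i _ => mul_nonneg (hf i) (hu i)
    obtain ⟨j, hj⟩ := D.exists_simple_mul_length_lt hw
    have h1 := ih _ (by omega) (D.simple j * w) rfl
    have h2 : D.length (D.simple j * w) ≤ D.length (D.simple j * (D.simple j * w)) := by
      rw [simple_mul_simple_mul]; omega
    have h3 := D.coroot_smul_nonneg_of_length_le h2 hu
    have h4 : w • u = D.simple j • ((D.simple j * w) • u) := by
      rw [smul_smul, simple_mul_simple_mul]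
    rw [h4]
    generalize (D.simple j * w) • u = z at h1 h3
    rw [simple_smul, map_sub, map_smul, smul_eq_mul]
    have := mul_nonpos_of_nonneg_of_nonpos h3 (hfA j)
    linarith

/-- If h_j(wu) < 0, reflecting in j cannot make the value of f negative, which forces f(α_j) = 0. By
induction the reflected point lies in R(Θ), so j ∉ Θ; then f(α_j) is a sum of nonpositive terms, all
zero, and j ∈ Θ^⊥. At a point of the closed chamber the terms f_i h_i are nonnegative and all
vanish. -/
theorem mem_specialFace_of_corootForm_eq_zero {Θ : Set ι} {f : ι → ℝ} (hf : ∀ i ∈ Θ, 0 < f i)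
    (hf0 : ∀ i, i ∉ Θ → f i = 0) (hfA : ∀ j, D.corootForm f (D.root j) ≤ 0) {v : V}
    (hv : v ∈ D.titsCone) (hfv : D.corootForm f v = 0) : v ∈ D.specialFace Θ := by
  have hfn : ∀ i, 0 ≤ f i := fun i => by
    by_cases hi : i ∈ Θ
    · exact (hf i hi).le
    · exact (hf0 i hi).ge
  obtain ⟨w, u, hu, rfl⟩ := hv
  induction hn : D.length w using Nat.strong_induction_on generalizing w with
  | _ n ih =>
    subst hn
    by_cases hc : w • u ∈ D.closedChamber
    · refine D.closedFacet_subset_specialFace Θ ⟨fun i hi => ?_, fun i _ => hc i⟩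
      rw [corootForm_apply] at hfv
      have := (Finset.sum_eq_zero_iff_of_nonneg fun i _ => mul_nonneg (hfn i) (hc i)).1 hfv i
        (Finset.mem_univ i)
      exact (mul_eq_zero.1 this).resolve_left (hf i hi).ne'
    obtain ⟨j, hj⟩ : ∃ j, D.coroot j (w • u) < 0 := by
      by_contra! h
      exact hc h
    have h1 : D.corootForm f ((D.simple j * w) • u) =
        -(D.coroot j (w • u) * D.corootForm f (D.root j)) := by
      rw [mul_smul, simple_smul, map_sub, hfv, map_smul, smul_eq_mul, zero_sub]
    have h2 := D.corootForm_nonneg hfn hfA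
      (D.smul_mem_titsCone (D.simple j * w) (D.closedChamber_subset_titsCone hu))
    have h3 : D.corootForm f (D.root j) = 0 := by
      refine le_antisymm (hfA j) ?_
      by_contra! h
      have := mul_pos_of_neg_of_neg hj h
      linarith
    have h4 := ih _ (D.length_simple_mul_lt hu hj) (D.simple j * w) (by rw [h1, h3]; simp) rfl
    have hjΘ : j ∉ Θ := by
      intro hjΘ
      have := coroot_eq_zero_of_mem_specialFace h4 hjΘ
      rw [mul_smul, coroot_simple_smul_self] at this
      linarith
    have hjorth : j ∈ orthSet A Θ := by
      intro i hi
      rw [corootForm_root] at h3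
      have hterm : ∀ k ∈ Finset.univ, f k * (A k j : ℝ) ≤ 0 := fun k _ => by
        by_cases hk : k = j
        · rw [hk, hf0 j hjΘ, zero_mul]
        · exact mul_nonpos_of_nonneg_of_nonpos (hfn k) (D.isGCM.cast_nonpos hk)
      have := (Finset.sum_eq_zero_iff_of_nonpos hterm).1 h3 i (Finset.mem_univ i)
      have h5 := (mul_eq_zero.1 this).resolve_left (hf i hi).ne'
      exact D.isGCM.zero_symm _ _ (by exact_mod_cast h5)
    obtain ⟨a, ha, u', hu', h5⟩ := h4
    refine ⟨D.simple j * a, mul_mem (D.simple_mem_parabolic hjorth) ha, u', hu', ?_⟩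
    rw [mul_smul (D.simple j) a, ← h5, smul_smul, simple_mul_simple_mul]

variable {Θ : Set ι}

/-- This description removes the group W_{Θ^⊥}: for a point of X, membership in R(Θ) becomes a
system of linear equations. -/
theorem mem_specialFace_iff (hΘ : IsSpecial A Θ) {v : V} :
    v ∈ D.specialFace Θ ↔ v ∈ D.titsCone ∧ ∀ i ∈ Θ, D.coroot i v = 0 := by
  refine ⟨fun h => ⟨D.specialFace_subset_titsCone Θ h,
    fun i hi => coroot_eq_zero_of_mem_specialFace h hi⟩, fun ⟨h, h0⟩ => ?_⟩
  obtain ⟨f, hf, hf0, hfA⟩ := D.isGCM.exists_pos_of_isSpecial hΘ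
  refine D.mem_specialFace_of_corootForm_eq_zero hf hf0
    (fun j => by rw [corootForm_root]; exact hfA j) h ?_
  rw [corootForm_apply]
  refine Finset.sum_eq_zero fun i _ => ?_
  by_cases hi : i ∈ Θ
  · rw [h0 i hi, mul_zero]
  · rw [hf0 i hi, zero_mul]

/-- For special `Θ` the set `R(Θ)` is a face of the Tits cone. -/
theorem exists_face_eq_specialFace (hΘ : IsSpecial A Θ) :
    ∃ R : D.Face, R.carrier = D.specialFace Θ := by
  obtain ⟨f, hf, hf0, hfA⟩ := D.isGCM.exists_pos_of_isSpecial hΘ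
  have hfA' : ∀ j, D.corootForm f (D.root j) ≤ 0 := fun j => by
    rw [corootForm_root]; exact hfA j
  have hfn : ∀ i, 0 ≤ f i := fun i => by
    by_cases hi : i ∈ Θ
    · exact (hf i hi).le
    · exact (hf0 i hi).ge
  -- The exposed face cut out by the form f, which is nonnegative on X.
  let C : PointedCone ℝ V :=
    D.titsConvexCone ⊓ PointedCone.ofSubmodule (LinearMap.ker (D.corootForm f))
  have hC : ∀ v, v ∈ C ↔ v ∈ D.titsCone ∧ D.corootForm f v = 0 := fun v => by
    rw [← mem_titsConvexCone]; rfl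
  refine ⟨⟨C, inf_le_left, fun {x y a} hx hy ha h => ?_⟩, Set.ext fun v => ?_⟩
  · rw [mem_titsConvexCone] at hx hy
    rw [hC] at h ⊢
    refine ⟨hx, ?_⟩
    have h1 := D.corootForm_nonneg hfn hfA' hx
    have h2 := D.corootForm_nonneg hfn hfA' hy
    have h3 := h.2
    rw [map_add, map_smul, smul_eq_mul] at h3
    have h4 := mul_nonneg ha.le h1
    have h5 : a * D.corootForm f x = 0 := by linarith
    exact (mul_eq_zero.1 h5).resolve_left ha.ne'
  · change v ∈ C ↔ _
    rw [hC]
    refine ⟨fun h => D.mem_specialFace_of_corootForm_eq_zero hf hf0 hfA' h.1 h.2, fun h => ?_⟩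
    rw [mem_specialFace_iff D hΘ] at h
    refine ⟨h.1, ?_⟩
    rw [corootForm_apply]
    refine Finset.sum_eq_zero fun i _ => ?_
    by_cases hi : i ∈ Θ
    · rw [h.2 i hi, mul_zero]
    · rw [hf0 i hi, zero_mul]

/-! ### Facets and faces -/

theorem exists_pos_add_mul_nonneg (a b : ι → ℝ) :
    ∃ ε : ℝ, 0 < ε ∧ ∀ i, 0 < a i → 0 ≤ a i + ε * b i := by
  have h : ∀ᶠ ε : ℝ in nhdsWithin 0 (Set.Ioi 0), ∀ i, 0 < a i → 0 ≤ a i + ε * b i := by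
    rw [Filter.eventually_all]
    intro i
    by_cases hi : 0 < a i
    · have ht : Filter.Tendsto (fun ε : ℝ => a i + ε * b i) (nhdsWithin 0 (Set.Ioi 0))
          (nhds (a i + 0 * b i)) :=
        (Continuous.tendsto (by fun_prop) 0).mono_left nhdsWithin_le_nhds
      rw [zero_mul, add_zero] at ht
      filter_upwards [ht.eventually (eventually_gt_nhds hi)] with ε hε _ using hε.le
    · exact Filter.Eventually.of_forall fun ε h => absurd h hi
  obtain ⟨ε, h1, h2⟩ := (h.and self_mem_nhdsWithin).exists
  exact ⟨ε, h2, h1⟩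

/-- Some w in the parabolic subgroup of J \ J^∞ fixes u and makes -μ dominant for J \ J^∞. On J^∞
the coroots of w(-μ) vanish by orthogonality. Outside J the strict positivity of h_i(u) absorbs a
small multiple. Thus F_J is relatively interior to R(J^∞). -/
theorem exists_sub_smul_mem_titsCone {J : Set ι} {u μ : V} (hu : u ∈ D.openFacet J)
    (hμ : ∀ i ∈ infinitePart A J, D.coroot i μ = 0) :
    ∃ ε : ℝ, 0 < ε ∧ u - ε • μ ∈ D.titsCone := by
  obtain ⟨w, hw, hdom⟩ := D.exists_dominant J (-μ)
  obtain ⟨ε, hε, h⟩ := exists_pos_add_mul_nonneg (fun i => D.coroot i u)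
    (fun i => D.coroot i (w • -μ))
  refine ⟨ε, hε, ?_⟩
  have hwu : w • u = u := D.smul_eq_self_of_mem_parabolic hw fun i hi => hu.1 i hi.1
  have hmem : w • (u - ε • μ) ∈ D.closedChamber := by
    have h1 : w • (u - ε • μ) = u + ε • (w • -μ) := by
      rw [sub_eq_add_neg, ← smul_neg, smul_add w, hwu, smul_real_smul]
    rw [h1]
    intro i
    rw [map_add, map_smul, smul_eq_mul]
    by_cases hi : i ∈ J
    · rw [hu.1 i hi, zero_add]
      by_cases hi' : i ∈ infinitePart A J
      · rw [D.coroot_smul_of_mem_parabolic hw fun k hk =>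
          D.isGCM.zero_symm _ _ (D.isGCM.eq_zero_of_mem_infinitePart hk hi'), map_neg, hμ i hi']
        simp
      · exact mul_nonneg hε.le (hdom i ⟨hi, hi'⟩)
    · exact h i (hu.2 i hi)
  have := D.smul_mem_titsCone w⁻¹ (D.closedChamber_subset_titsCone hmem)
  rwa [inv_smul_smul] at this

theorem openFacet_subset_specialFace (J : Set ι) :
    D.openFacet J ⊆ D.specialFace (infinitePart A J) := fun _ hu =>
  D.closedFacet_subset_specialFace _ (D.mem_closedFacet_iff.2
    ⟨D.openFacet_subset_closedChamber J hu, fun i hi => hu.1 i hi.1⟩)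

variable {D}

/-- The face `R(J^∞)` is contained in every face that meets `F_J`. -/
theorem Face.specialFace_subset {R : D.Face} {J : Set ι} {u : V} (hu : u ∈ D.openFacet J)
    (huR : u ∈ R.carrier) : D.specialFace (infinitePart A J) ⊆ R.carrier := by
  intro μ hμ
  rw [D.mem_specialFace_iff (D.isGCM.isSpecial_infinitePart J)] at hμ
  obtain ⟨ε, hε, h⟩ := D.exists_sub_smul_mem_titsCone hu hμ.2
  -- The point u of the face is the sum of εμ and u - εμ, both in X, so the face contains μ.
  refine R.isFace.mem_of_smul_add_mem (D.mem_titsConvexCone.2 hμ.1) (D.mem_titsConvexCone.2 h) hε ?_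
  rw [add_sub_cancel]
  exact huR

/-- Every face is a union of open facets, because F_J ⊆ R(J^∞). -/
theorem Face.smul_openFacet_mem {R : D.Face} {J : Set ι} {τ : D.weylGroup} {u u' : V}
    (hu : u ∈ D.openFacet J) (hu' : u' ∈ D.openFacet J) (h : τ • u ∈ R.carrier) :
    τ • u' ∈ R.carrier := by
  have h1 : u ∈ (R.translate τ⁻¹).carrier := by rw [Face.mem_translate, inv_inv]; exact h
  have h2 := Face.specialFace_subset hu h1 (D.openFacet_subset_specialFace J hu')
  rwa [Face.mem_translate, inv_inv] at h2

/-- Every face of the Tits cone is a translate of a special face. -/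
theorem Face.exists_eq_translate [FiniteDimensional ℝ V] (R : D.Face) :
    ∃ (Θ : Set ι) (R₀ : D.Face) (τ : D.weylGroup), IsSpecial A Θ ∧
      R₀.carrier = D.specialFace Θ ∧ R = R₀.translate τ := by
  -- A relative interior point τu determines the face: with J the type of u, both R and τR(J^∞)
  -- contain it, and each contains the other by the defining property of faces.
  obtain ⟨v, hv, hint⟩ := R.exists_relative_interior
  obtain ⟨τ, u, hu, rfl⟩ := D.mem_titsConvexCone.1 (R.isFace.le hv)
  have huJ : u ∈ D.openFacet {i | D.coroot i u = 0} := D.mem_openFacet_iff.2 ⟨hu, rfl⟩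
  obtain ⟨R₀, hR₀⟩ := D.exists_face_eq_specialFace
    (D.isGCM.isSpecial_infinitePart {i | D.coroot i u = 0})
  refine ⟨_, R₀, τ, D.isGCM.isSpecial_infinitePart _, hR₀, Face.ext_carrier fun μ => ?_⟩
  constructor
  · intro hμ
    obtain ⟨ε, hε, h⟩ := hint μ hμ
    refine (R₀.translate τ).isFace.mem_of_smul_add_mem (R.isFace.le hμ) (R.isFace.le h) hε ?_
    rw [add_sub_cancel]
    change τ • u ∈ (R₀.translate τ).carrier
    rw [Face.mem_translate, inv_smul_smul, hR₀]
    exact D.openFacet_subset_specialFace _ huJ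
  · intro hμ
    rw [Face.mem_translate, hR₀] at hμ
    have h1 : u ∈ (R.translate τ⁻¹).carrier := by rw [Face.mem_translate, inv_inv]; exact hv
    have h2 := Face.specialFace_subset huJ h1 hμ
    rwa [Face.mem_translate, inv_inv, smul_inv_smul] at h2

end Special

end FreeRealization

end

noncomputable section

namespace FreeRealization

variable {ι : Type*} {A : Matrix ι ι ℤ} {V : Type*} [AddCommGroup V] [Module ℝ V]
  (D : FreeRealization A V)

/-! ### Cosets and facets -/

section Facets

variable {D} in
theorem mem_coset {σ τ : D.weylGroup} {J : Set ι} :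
    τ ∈ (D.coset σ J).carrier ↔ σ⁻¹ * τ ∈ D.parabolic J := by
  constructor
  · rintro ⟨w, hw, rfl⟩
    rwa [inv_mul_cancel_left]
  · exact fun h => ⟨_, h, (mul_inv_cancel_left σ τ).symm⟩

variable {D} in
theorem CoxeterComplex.exists_eq_coset (c : D.CoxeterComplex) : ∃ σ J, c = D.coset σ J := by
  obtain ⟨s, σ, J, h⟩ := c
  exact ⟨σ, J, CoxeterComplex.carrier_injective h⟩

variable {D} in
theorem facetOf_subset_titsCone (c : D.CoxeterComplex) : D.facetOf c ⊆ D.titsCone := by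
  rintro _ ⟨τ, J, -, u, hu, rfl⟩
  exact ⟨τ, u, D.openFacet_subset_closedChamber J hu, rfl⟩

variable {D} in
theorem Face.zero_mem_carrier (R : D.Face) : (0 : V) ∈ R.carrier := R.cone.zero_mem

variable {D} in
theorem coset_eq_of_mem {σ τ : D.weylGroup} {J : Set ι} (h : σ⁻¹ * τ ∈ D.parabolic J) :
    D.coset σ J = D.coset τ J := by
  refine CoxeterComplex.carrier_injective (Set.ext fun ρ => ?_)
  rw [mem_coset, mem_coset]
  have h1 : σ⁻¹ * ρ = (σ⁻¹ * τ) * (τ⁻¹ * ρ) := by group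
  rw [h1, Subgroup.mul_mem_cancel_left _ h]

variable {D} in
-- Disjointness of the open facets: the closed chamber is a fundamental domain, and the stabilizer
-- of a point of F_J is W_J.
theorem eq_of_mem_facetOf {c c' : D.CoxeterComplex} {v : V} (h : v ∈ D.facetOf c)
    (h' : v ∈ D.facetOf c') : c = c' := by
  obtain ⟨τ, J, rfl, u, hu, rfl⟩ := h
  obtain ⟨τ', J', rfl, u', hu', h⟩ := h'
  have h1 : (τ'⁻¹ * τ) • u = u' := by rw [mul_smul, h, inv_smul_smul]
  obtain ⟨h2, h3⟩ := D.eq_and_mem_parabolic_of_smul_mem (w := τ'⁻¹ * τ)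
    (D.openFacet_subset_closedChamber J hu)
    (by rw [h1]; exact D.openFacet_subset_closedChamber J' hu')
  rw [h1] at h2
  subst h2
  rw [(D.mem_openFacet_iff.1 hu').2] at h3
  have h4 : J = J' := (D.mem_openFacet_iff.1 hu).2.symm.trans (D.mem_openFacet_iff.1 hu').2
  subst h4
  exact (coset_eq_of_mem h3).symm

variable [Finite ι]

/-- A point of F_J is fixed by W_J but moved by σ_i for i ∉ J. Hence J is recovered from W_J, and a
coset determines its type. -/
theorem mem_of_simple_mem_parabolic {J : Set ι} {i : ι} (h : D.simple i ∈ D.parabolic J) :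
    i ∈ J := by
  obtain ⟨u, hu⟩ := D.openFacet_nonempty J
  by_contra hi
  have h1 := D.smul_eq_self_of_mem_parabolic h hu.1
  have h2 := D.coroot_simple_smul_self i u
  rw [h1] at h2
  linarith [hu.2 i hi]

theorem subset_of_parabolic_le {J K : Set ι} (h : D.parabolic J ≤ D.parabolic K) : J ⊆ K :=
  fun _ hi => D.mem_of_simple_mem_parabolic (h (D.simple_mem_parabolic hi))

variable {D}

theorem coset_eq_iff {σ τ : D.weylGroup} {J K : Set ι} :
    D.coset σ J = D.coset τ K ↔ J = K ∧ σ⁻¹ * τ ∈ D.parabolic J := by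
  constructor
  · intro h
    have h1 : σ⁻¹ * τ ∈ D.parabolic J := by
      rw [← mem_coset, h, mem_coset, inv_mul_cancel]
      exact one_mem _
    rw [coset_eq_of_mem h1] at h
    have h2 : D.parabolic J = D.parabolic K := by
      ext w
      have h3 := congrArg (fun c => τ * w ∈ c.carrier) h
      simp only [mem_coset, inv_mul_cancel_left] at h3
      exact iff_of_eq h3
    exact ⟨Set.Subset.antisymm (D.subset_of_parabolic_le h2.le)
      (D.subset_of_parabolic_le h2.ge), h1⟩
  · rintro ⟨rfl, h⟩
    exact coset_eq_of_mem h

theorem mem_facetOf_coset {τ : D.weylGroup} {J : Set ι} {v : V} :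
    v ∈ D.facetOf (D.coset τ J) ↔ τ⁻¹ • v ∈ D.openFacet J := by
  constructor
  · rintro ⟨τ', J', hc, u, hu, rfl⟩
    obtain ⟨rfl, h⟩ := coset_eq_iff.1 hc
    rw [smul_smul, D.smul_eq_self_of_mem_parabolic h hu.1]
    exact hu
  · exact fun h => ⟨τ, J, rfl, _, h, (smul_inv_smul τ v).symm⟩

theorem smul_mem_facetOf_coset {τ : D.weylGroup} {J : Set ι} {u : V} (hu : u ∈ D.openFacet J) :
    τ • u ∈ D.facetOf (D.coset τ J) := by
  rw [mem_facetOf_coset, inv_smul_smul]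
  exact hu

theorem facetOf_nonempty (c : D.CoxeterComplex) : (D.facetOf c).Nonempty := by
  obtain ⟨τ, J, rfl⟩ := c.exists_eq_coset
  obtain ⟨u, hu⟩ := D.openFacet_nonempty J
  exact ⟨_, smul_mem_facetOf_coset hu⟩

theorem zero_mem_facetOf : (0 : V) ∈ D.facetOf (D.coset 1 Set.univ) := by
  rw [mem_facetOf_coset, smul_zero]
  exact ⟨fun i _ => map_zero _, fun i hi => absurd (Set.mem_univ i) hi⟩

end Facets

/-! ### Elements of the face monoid -/

section Monoid

variable {D}

theorem FaceMonoid.exists_eq_mk (x : D.FaceMonoid) : ∃ σ R, x = FaceMonoid.mk σ R := by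
  induction x using Con.induction_on with
  | _ a => exact ⟨a.w, a.face, rfl⟩

theorem FaceMonoid.mk_eq_mk {σ τ : D.weylGroup} {R S : D.Face} (h : R = S)
    (h' : ∀ v ∈ R.carrier, σ • v = τ • v) : FaceMonoid.mk σ R = FaceMonoid.mk τ S := by
  refine (Con.eq D.faceCon).2 ⟨h, (mem_fixingSubgroup_iff _).2 fun v hv => ?_⟩
  rw [mul_smul, inv_smul_eq_iff]
  exact (h' v hv).symm

theorem FaceMonoid.ofWeyl_mul_idem_mul_ofWeyl (σ₁ σ₂ : D.weylGroup) (R : D.Face) :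
    FaceMonoid.ofWeyl σ₁ * FaceMonoid.idem R * FaceMonoid.ofWeyl σ₂ =
      FaceMonoid.mk (σ₁ * σ₂) (R.translate σ₂⁻¹) := by
  have h : FaceMonoid.ofWeyl σ₁ * FaceMonoid.idem R * FaceMonoid.ofWeyl σ₂ =
      FaceMonoid.mk (σ₁ * 1 * σ₂) (((((Face.whole D).translate (1 : D.weylGroup)⁻¹).inter
        R).translate σ₂⁻¹).inter (Face.whole D)) := rfl
  rw [h]
  refine FaceMonoid.mk_eq_mk (Face.ext_carrier fun v => ?_) fun v _ => by rw [mul_one]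
  simp only [Face.mem_inter, Face.mem_translate, inv_inv, one_smul]
  refine ⟨fun h => h.1.2, fun h => ⟨⟨Face.mem_whole_of_mem h, h⟩, ?_⟩⟩
  have h1 : v ∈ (R.translate σ₂⁻¹).carrier := by rwa [Face.mem_translate, inv_inv]
  exact Face.mem_whole_of_mem h1

theorem FaceMonoid.ofWeyl_mul_idem (σ : D.weylGroup) (R : D.Face) :
    FaceMonoid.ofWeyl σ * FaceMonoid.idem R = FaceMonoid.mk σ R := by
  have h : FaceMonoid.ofWeyl σ * FaceMonoid.idem R =
      FaceMonoid.mk (σ * 1) (((Face.whole D).translate (1 : D.weylGroup)⁻¹).inter R) := rfl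
  rw [h]
  refine FaceMonoid.mk_eq_mk (Face.ext_carrier fun v => ?_) fun v _ => by rw [mul_one]
  simp only [Face.mem_inter, Face.mem_translate, inv_inv, one_smul]
  exact ⟨fun h => h.2, fun h => ⟨Face.mem_whole_of_mem h, h⟩⟩

theorem FaceMonoid.coe_mk_smul_of_mem {σ : D.weylGroup} {R : D.Face} {v : D.titsCone}
    (h : (v : V) ∈ R.carrier) : ((FaceMonoid.mk σ R • v : D.titsCone) : V) = σ • (v : V) :=
  FaceSemidirect.coe_titsMap_of_mem (x := ⟨σ, R⟩) D h

theorem FaceMonoid.coe_mk_smul_of_notMem {σ : D.weylGroup} {R : D.Face} {v : D.titsCone}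
    (h : (v : V) ∉ R.carrier) : ((FaceMonoid.mk σ R • v : D.titsCone) : V) = 0 :=
  FaceSemidirect.coe_titsMap_of_notMem (x := ⟨σ, R⟩) D h

end Monoid

/-! ### The action on the Coxeter complex -/

section Action

variable [Fintype ι]

variable {D}

/-- The facet lies in R or misses it, so σ⌈R⌉ acts on it by σ or sends it to 0 ∈ F_I. -/
theorem exists_smul_mem_facetOf (x : D.FaceMonoid) (c : D.CoxeterComplex) :
    ∃ c', ∀ v : D.titsCone, (v : V) ∈ D.facetOf c → ((x • v : D.titsCone) : V) ∈ D.facetOf c' := by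
  obtain ⟨σ, R, rfl⟩ := x.exists_eq_mk
  obtain ⟨τ, J, rfl⟩ := c.exists_eq_coset
  by_cases h : ∃ u ∈ D.openFacet J, τ • u ∈ R.carrier
  · obtain ⟨u, hu, huR⟩ := h
    refine ⟨D.coset (σ * τ) J, fun v hv => ?_⟩
    rw [mem_facetOf_coset] at hv
    have h1 := Face.smul_openFacet_mem hu hv huR
    rw [smul_inv_smul] at h1
    rw [FaceMonoid.coe_mk_smul_of_mem h1, mem_facetOf_coset, mul_inv_rev, mul_smul, inv_smul_smul]
    exact hv
  · refine ⟨D.coset 1 Set.univ, fun v hv => ?_⟩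
    rw [FaceMonoid.coe_mk_smul_of_notMem]
    · exact zero_mem_facetOf
    · intro hR
      rw [mem_facetOf_coset] at hv
      exact h ⟨_, hv, by rwa [smul_inv_smul]⟩

/-- The element of the Coxeter complex whose facet contains the image of the facet of `c`
under `x`. -/
def facetMap (x : D.FaceMonoid) (c : D.CoxeterComplex) : D.CoxeterComplex :=
  (exists_smul_mem_facetOf x c).choose

theorem smul_mem_facetOf_facetMap {x : D.FaceMonoid} {c : D.CoxeterComplex} {v : D.titsCone}
    (hv : (v : V) ∈ D.facetOf c) : ((x • v : D.titsCone) : V) ∈ D.facetOf (facetMap x c) :=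
  (exists_smul_mem_facetOf x c).choose_spec v hv

theorem facetMap_eq {x : D.FaceMonoid} {c c' : D.CoxeterComplex} {v : D.titsCone}
    (hv : (v : V) ∈ D.facetOf c) (hv' : ((x • v : D.titsCone) : V) ∈ D.facetOf c') :
    facetMap x c = c' :=
  eq_of_mem_facetOf (smul_mem_facetOf_facetMap hv) hv'

theorem facetMap_of_mem {σ τ : D.weylGroup} {R : D.Face} {J : Set ι} {u : V}
    (hu : u ∈ D.openFacet J) (h : τ • u ∈ R.carrier) :
    facetMap (FaceMonoid.mk σ R) (D.coset τ J) = D.coset (σ * τ) J := by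
  have hv := smul_mem_facetOf_coset (τ := τ) hu
  refine facetMap_eq (v := ⟨τ • u, facetOf_subset_titsCone _ hv⟩) hv ?_
  rw [FaceMonoid.coe_mk_smul_of_mem h, smul_smul]
  exact smul_mem_facetOf_coset hu

theorem facetMap_of_notMem {σ τ : D.weylGroup} {R : D.Face} {J : Set ι} {u : V}
    (hu : u ∈ D.openFacet J) (h : τ • u ∉ R.carrier) :
    facetMap (FaceMonoid.mk σ R) (D.coset τ J) = D.coset 1 Set.univ := by
  have hv := smul_mem_facetOf_coset (τ := τ) hu
  refine facetMap_eq (v := ⟨τ • u, facetOf_subset_titsCone _ hv⟩) hv ?_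
  rw [FaceMonoid.coe_mk_smul_of_notMem h]
  exact zero_mem_facetOf

variable (D) in
/-- The action of the face monoid on the Coxeter complex induced by its action on the
Tits cone. -/
@[reducible] def badAction : MulAction D.FaceMonoid D.CoxeterComplex where
  smul := facetMap
  one_smul c := by
    obtain ⟨v, hv⟩ := facetOf_nonempty c
    refine facetMap_eq (v := ⟨v, facetOf_subset_titsCone _ hv⟩) hv ?_
    rw [one_smul]
    exact hv
  -- The multiplication law is inherited from X: one vector of the facet, followed through y and
  -- then x, determines the target coset.
  mul_smul x y c := by
    obtain ⟨v, hv⟩ := facetOf_nonempty c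
    refine facetMap_eq (v := ⟨v, facetOf_subset_titsCone _ hv⟩) hv ?_
    rw [mul_smul]
    exact smul_mem_facetOf_facetMap (smul_mem_facetOf_facetMap hv)

/-- Here vW_K ≤ W_Θ means W_Θ ⊆ vW_K, that is v ∈ W_K and Θ ⊆ K. The closed facet of Θ is the union
of the F_K with K ⊇ Θ. -/
theorem coset_mem_sweep_iff {Θ J : Set ι} {τ : D.weylGroup} {u : V} (hu : u ∈ D.openFacet J) :
    D.coset τ J ∈ D.sweep Θ ↔ τ • u ∈ D.specialFace Θ := by
  constructor
  · rintro ⟨a, ha, v, K, hv, hc⟩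
    have hv' : (D.coset 1 Θ).carrier ⊆ (D.coset v K).carrier := hv
    have h1 : ∀ w ∈ D.parabolic Θ, v⁻¹ * w ∈ D.parabolic K := fun w hw =>
      mem_coset.1 (hv' (mem_coset.2 (by rwa [inv_one, one_mul])))
    have h2 : v⁻¹ ∈ D.parabolic K := by simpa using h1 1 (one_mem _)
    have h3 : Θ ⊆ K := D.subset_of_parabolic_le fun w hw =>
      (Subgroup.mul_mem_cancel_left _ h2).1 (h1 w hw)
    have h4 : D.coset (a * v) K = D.coset a K :=
      coset_eq_of_mem (by simpa using h2)
    have h5 := smul_mem_facetOf_coset (τ := τ) hu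
    rw [hc, h4, mem_facetOf_coset] at h5
    refine ⟨a, ha, _, ?_, (smul_inv_smul a (τ • u)).symm⟩
    exact D.mem_closedFacet_iff.2 ⟨D.openFacet_subset_closedChamber K h5,
      fun i hi => h5.1 i (h3 hi)⟩
  · rintro ⟨a, ha, u', hu', h⟩
    have h1 : u' ∈ D.openFacet {i | D.coroot i u' = 0} :=
      D.mem_openFacet_iff.2 ⟨D.closedFacet_subset_closedChamber Θ hu', rfl⟩
    refine ⟨a, ha, 1, {i | D.coroot i u' = 0}, ?_, ?_⟩
    · change (D.coset 1 Θ).carrier ⊆ (D.coset 1 {i | D.coroot i u' = 0}).carrier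
      intro w hw
      rw [mem_coset] at hw ⊢
      exact D.parabolic_mono (fun i hi => hu'.1 i hi) hw
    · rw [mul_one]
      refine eq_of_mem_facetOf (smul_mem_facetOf_coset hu) ?_
      rw [h]
      exact smul_mem_facetOf_coset h1

variable (D) in
theorem isBadAction_badAction : D.IsBadAction D.badAction := by
  intro Θ R _ hR σ₁ σ₂ τ J
  obtain ⟨u, hu⟩ := D.openFacet_nonempty J
  have h : D.coset (σ₂ * τ) J ∈ D.sweep Θ ↔ τ • u ∈ (R.translate σ₂⁻¹).carrier := by
    rw [coset_mem_sweep_iff hu, Face.mem_translate, inv_inv, hR, mul_smul]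
  rw [FaceMonoid.ofWeyl_mul_idem_mul_ofWeyl, h]
  exact ⟨fun h => facetMap_of_mem hu h, fun h => facetMap_of_notMem hu h⟩

/-- A facet inside R keeps its type J, while one outside is sent to type I. The only ambiguous case
is J = I, and F_I lies in every face because it contains 0. -/
theorem mem_face_iff_facetMap_ne {σ τ : D.weylGroup} {R : D.Face} {J : Set ι} {u : V}
    (hu : u ∈ D.openFacet J) :
    τ • u ∈ R.carrier ↔
      facetMap (FaceMonoid.mk σ R) (D.coset τ J) ≠ D.coset 1 Set.univ ∨ J = Set.univ := by
  constructor
  · intro h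
    rw [facetMap_of_mem hu h, or_iff_not_imp_right]
    exact fun hJ h' => hJ (coset_eq_iff.1 h').1
  · intro h
    by_contra hn
    rcases h with h | rfl
    · exact h (facetMap_of_notMem hu hn)
    · have h0 : (0 : V) ∈ D.openFacet Set.univ :=
        ⟨fun i _ => map_zero _, fun i hi => absurd (Set.mem_univ i) hi⟩
      exact hn (Face.smul_openFacet_mem h0 hu (by rw [smul_zero]; exact R.zero_mem_carrier))

/-- The cosets sent to W_I determine the face R. On R, equal image cosets differ by an element of
W_J, which fixes F_J pointwise, so the two Weyl group elements agree on R. -/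
theorem eq_of_facetMap_eq {x y : D.FaceMonoid}
    (h : ∀ c : D.CoxeterComplex, facetMap x c = facetMap y c) : x = y := by
  obtain ⟨σ, R, rfl⟩ := x.exists_eq_mk
  obtain ⟨τ, S, rfl⟩ := y.exists_eq_mk
  have hRS : R = S := by
    refine Face.ext_carrier fun v => ?_
    have key : v ∈ D.titsCone → (v ∈ R.carrier ↔ v ∈ S.carrier) := by
      rintro ⟨ρ, u, hu, rfl⟩
      have hu' := D.mem_openFacet_iff.2 ⟨hu, rfl⟩
      rw [mem_face_iff_facetMap_ne (σ := σ) hu', mem_face_iff_facetMap_ne (σ := τ) hu', h]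
    exact ⟨fun hv => (key (D.mem_titsConvexCone.1 (R.isFace.le hv))).1 hv,
      fun hv => (key (D.mem_titsConvexCone.1 (S.isFace.le hv))).2 hv⟩
  subst hRS
  refine FaceMonoid.mk_eq_mk rfl fun v hv => ?_
  obtain ⟨ρ, u, hu, rfl⟩ := D.mem_titsConvexCone.1 (R.isFace.le hv)
  have hu' := D.mem_openFacet_iff.2 ⟨hu, rfl⟩
  have h1 := h (D.coset ρ {i | D.coroot i u = 0})
  rw [facetMap_of_mem hu' hv, facetMap_of_mem hu' hv] at h1
  have h2 := D.smul_eq_self_of_mem_parabolic (coset_eq_iff.1 h1).2 fun i hi => hi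
  rw [mul_smul, inv_smul_eq_iff, mul_smul, mul_smul] at h2
  exact h2.symm

variable (D) in
-- Fixing W_J forces F_J ⊆ R, equivalently R(J^∞) ⊆ R, and then σ ∈ W_J.
theorem stabilizer_coset (J : Set ι) :
    {x : D.FaceMonoid | facetMap x (D.coset 1 J) = D.coset 1 J} = D.parabolicSubmonoid J := by
  obtain ⟨u, hu⟩ := D.openFacet_nonempty J
  have hu1 : (1 : D.weylGroup) • u = u := one_smul _ _
  ext x
  constructor
  · intro hx
    obtain ⟨σ, R, rfl⟩ := x.exists_eq_mk
    have hx' : facetMap (FaceMonoid.mk σ R) (D.coset 1 J) = D.coset 1 J := hx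
    have hR : (1 : D.weylGroup) • u ∈ R.carrier := by
      rw [mem_face_iff_facetMap_ne (σ := σ) hu, hx', or_iff_not_imp_right]
      exact fun hJ h => hJ (coset_eq_iff.1 h).1
    rw [facetMap_of_mem hu hR, mul_one] at hx'
    have hσ := (coset_eq_iff.1 hx').2
    rw [mul_one, inv_mem_iff] at hσ
    rw [hu1] at hR
    exact ⟨σ, hσ, R, Face.specialFace_subset hu hR, (FaceMonoid.ofWeyl_mul_idem σ R).symm⟩
  · rintro ⟨w, hw, R, hR, rfl⟩
    change facetMap _ _ = _
    rw [FaceMonoid.ofWeyl_mul_idem, facetMap_of_mem hu, mul_one]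
    · exact coset_eq_of_mem (by simpa using hw)
    · rw [hu1]
      exact hR (D.openFacet_subset_specialFace J hu)

variable (D) in
-- The idempotent of R(Θ) fixes W_Θ but sends the larger element W_∅ to W_I, and W_Θ ≤ W_I would
-- force Θ = I.
theorem not_isOrderPreserving_badAction {Θ : Set ι} (hΘ : IsSpecial A Θ) (h0 : Θ ≠ ∅)
    (h1 : Θ ≠ Set.univ) : ¬ D.IsOrderPreserving D.badAction := by
  intro hord
  obtain ⟨R, hR⟩ := D.exists_face_eq_specialFace hΘ
  obtain ⟨u, hu⟩ := D.openFacet_nonempty Θ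
  obtain ⟨v, hv⟩ := D.openFacet_nonempty (∅ : Set ι)
  have hle : D.coset 1 Θ ≤ D.coset 1 ∅ := by
    change (D.coset 1 ∅).carrier ⊆ (D.coset 1 Θ).carrier
    intro w hw
    rw [mem_coset] at hw ⊢
    exact D.parabolic_mono (Set.empty_subset Θ) hw
  have h2 : facetMap (FaceMonoid.mk 1 R) (D.coset 1 Θ) ≤
      facetMap (FaceMonoid.mk 1 R) (D.coset 1 ∅) := hord _ _ _ hle
  rw [facetMap_of_mem hu, facetMap_of_notMem hv, mul_one] at h2
  · have h3 : (D.coset 1 Set.univ).carrier ⊆ (D.coset 1 Θ).carrier := h2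
    refine h1 (Set.eq_univ_of_univ_subset (D.subset_of_parabolic_le fun w hw => ?_))
    have := mem_coset.1 (h3 (mem_coset.2 (by rwa [inv_one, one_mul])))
    rwa [inv_one, one_mul] at this
  · rw [one_smul, hR]
    obtain ⟨i, hi⟩ := Set.nonempty_iff_ne_empty.2 h0
    exact fun h => (hv.2 i (Set.notMem_empty i)).ne' (coroot_eq_zero_of_mem_specialFace h hi)
  · rw [one_smul, hR]
    exact D.closedFacet_subset_specialFace Θ
      (D.mem_closedFacet_iff.2 ⟨D.openFacet_subset_closedChamber Θ hu, fun i hi => hu.1 i hi⟩)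

end Action

/-! ### A hyperbolic example -/

/-- A symmetric hyperbolic generalized Cartan matrix that contains an affine submatrix. -/
def hyperbolicMatrix : Matrix (Fin 3) (Fin 3) ℤ := !![2, -2, 0; -2, 2, -1; 0, -1, 2]

theorem isGCM_hyperbolicMatrix : IsGCM hyperbolicMatrix where
  diag := by decide
  nonpos i j := by fin_cases i <;> fin_cases j <;> decide
  zero_symm i j := by fin_cases i <;> fin_cases j <;> decide

theorem isUnit_hyperbolicMatrix : IsUnit (hyperbolicMatrix.map (Int.cast : ℤ → ℝ)) := by
  rw [Matrix.isUnit_iff_isUnit_det, isUnit_iff_ne_zero]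
  have h : hyperbolicMatrix.det = -2 := by decide
  have := Int.cast_det (R := ℝ) hyperbolicMatrix
  rw [h] at this
  intro h0
  rw [h0] at this
  norm_num at this

/-- The free realization in which the simple coroots are the coordinate forms. -/
def hyperbolicRealization : FreeRealization hyperbolicMatrix (Fin 3 → ℝ) where
  isGCM := isGCM_hyperbolicMatrix
  root j i := hyperbolicMatrix i j
  coroot i := LinearMap.proj i
  linearIndependent_root := Matrix.linearIndependent_cols_of_isUnit isUnit_hyperbolicMatrix
  linearIndependent_coroot := by
    rw [Fintype.linearIndependent_iff]
    intro g hg i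
    have := LinearMap.congr_fun hg (Pi.single i 1)
    simpa [LinearMap.sum_apply, Pi.single_apply] using this
  coroot_root i j := rfl

theorem isSpecial_hyperbolicMatrix : IsSpecial hyperbolicMatrix {0, 1} := by
  have hmem : ∀ i ∈ ({0, 1} : Set (Fin 3)), ∀ j ∈ ({0, 1} : Set (Fin 3)),
      j ∈ dynkinComponent hyperbolicMatrix {0, 1} i := by
    intro i hi j hj
    refine mem_dynkinComponent_of_ne (self_mem_dynkinComponent _ i) hi hj ?_
    rcases hi with rfl | rfl <;> rcases hj with rfl | rfl <;> decide
  have hset : ∀ i ∈ ({0, 1} : Set (Fin 3)),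
      dynkinComponent hyperbolicMatrix {0, 1} i = {0, 1} := fun i hi =>
    Set.Subset.antisymm (dynkinComponent_subset hi) (hmem i hi)
  refine Set.Subset.antisymm (fun i hi => ⟨hi, ?_⟩) (infinitePart_subset _)
  rw [hset i hi]
  rintro ⟨-, -, h⟩
  classical
  -- The affine block with rows (2, -2), (-2, 2) kills (-1, -1), which is neither positive nor zero.
  have h1 := h (fun _ => -1) fun i => ?_
  · have h0 : (0 : Fin 3) ∈ ({0, 1} : Set (Fin 3)) := by simp
    rcases h1 with h1 | h1
    · have := h1 ⟨0, h0⟩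
      norm_num at this
    · have := congrFun h1 ⟨0, h0⟩
      norm_num at this
  · have hsum : ∀ (_ : Fintype ({0, 1} : Set (Fin 3))) (g : Fin 3 → ℝ),
        ∑ k : ({0, 1} : Set (Fin 3)), g k = g 0 + g 1 := by
      intro _ g
      rw [← Finset.sum_subtype ({0, 1} : Finset (Fin 3)) (by simp) g]
      simp
    simp only [Matrix.mulVec, dotProduct, Matrix.map_apply, Matrix.submatrix_apply]
    refine le_of_eq (Eq.symm ((hsum _ fun k => (hyperbolicMatrix i k : ℝ) * -1).trans ?_))
    obtain ⟨i, rfl | rfl⟩ := i <;> simp [hyperbolicMatrix]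

end FreeRealization

end

theorem mainTheorem12 {ι : Type*} [Fintype ι] {A : Matrix ι ι ℤ} {V : Type*} [AddCommGroup V]
    [Module ℝ V] [FiniteDimensional ℝ V] (D : FreeRealization A V) :
    -- the Tits cone is a convex cone
    (D.titsConvexCone : Set V) = D.titsCone ∧
    -- `R(Θ)` is a face for special `Θ`, and every element of `Ŵ` is of the form `σ₁⌈R(Θ)⌉σ₂`
    (∀ Θ : Set ι, IsSpecial A Θ → ∃ R : D.Face, R.carrier = D.specialFace Θ) ∧
    (∀ x : D.FaceMonoid, ∃ (Θ : Set ι) (R : D.Face) (σ₁ σ₂ : D.weylGroup),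
      IsSpecial A Θ ∧ R.carrier = D.specialFace Θ ∧
      x = FreeRealization.FaceMonoid.ofWeyl σ₁ * FreeRealization.FaceMonoid.idem R *
        FreeRealization.FaceMonoid.ofWeyl σ₂) ∧
    -- the bad action
    (∃ act : MulAction D.FaceMonoid D.CoxeterComplex,
      -- it is given by the formula
      D.IsBadAction act ∧
      -- it is induced by the action on the Tits cone
      (∀ (x : D.FaceMonoid) (c : D.CoxeterComplex) (v : D.titsCone),
        (v : V) ∈ D.facetOf c → ((x • v : D.titsCone) : V) ∈ D.facetOf (x • c)) ∧
      -- it is faithful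
      (∀ x y : D.FaceMonoid, (∀ c : D.CoxeterComplex, x • c = y • c) → x = y) ∧
      -- the stabilizers are the standard parabolic submonoids
      (∀ J : Set ι, {x : D.FaceMonoid | x • D.coset 1 J = D.coset 1 J} =
        D.parabolicSubmonoid J) ∧
      -- it does not preserve the order as soon as there is a nontrivial special set
      ((∃ Θ : Set ι, IsSpecial A Θ ∧ Θ ≠ ∅ ∧ Θ ≠ Set.univ) → ¬ D.IsOrderPreserving act)) ∧
    -- there are cases, already for minimal realizations of symmetric matrices, in which the bad
    -- action does not preserve the order
    (∃ (n m : ℕ) (A' : Matrix (Fin n) (Fin n) ℤ) (D' : FreeRealization A' (Fin m → ℝ)),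
      A'.IsSymm ∧ m + (A'.map (Int.cast : ℤ → ℝ)).rank = 2 * n ∧
      ∃ act : MulAction D'.FaceMonoid D'.CoxeterComplex,
        D'.IsBadAction act ∧ ¬ D'.IsOrderPreserving act) := by
  refine ⟨D.coe_titsConvexCone, fun Θ hΘ => D.exists_face_eq_specialFace hΘ, fun x => ?_,
    ⟨D.badAction, D.isBadAction_badAction,
      fun x c v hv => FreeRealization.smul_mem_facetOf_facetMap hv,
      fun x y h => FreeRealization.eq_of_facetMap_eq h, fun J => D.stabilizer_coset J,
      fun ⟨Θ, hΘ, h0, h1⟩ => D.not_isOrderPreserving_badAction hΘ h0 h1⟩, ?_⟩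
  · obtain ⟨σ, R, rfl⟩ := x.exists_eq_mk
    obtain ⟨Θ, R₀, τ, hΘ, hR₀, rfl⟩ := R.exists_eq_translate
    -- This is σ⌈τR₀⌉ = στ⌈R₀⌉τ⁻¹.
    refine ⟨Θ, R₀, σ * τ, τ⁻¹, hΘ, hR₀, ?_⟩
    rw [FreeRealization.FaceMonoid.ofWeyl_mul_idem_mul_ofWeyl, inv_inv, mul_inv_cancel_right]
  · refine ⟨3, 3, _, FreeRealization.hyperbolicRealization, ?_, ?_, _,
      FreeRealization.isBadAction_badAction _,
      FreeRealization.not_isOrderPreserving_badAction _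
        FreeRealization.isSpecial_hyperbolicMatrix ?_ ?_⟩
    · ext i j
      fin_cases i <;> fin_cases j <;> rfl
    · rw [Matrix.rank_of_isUnit _ FreeRealization.isUnit_hyperbolicMatrix, Fintype.card_fin]
    · exact Set.nonempty_iff_ne_empty.1 ⟨0, by simp⟩
    · intro h
      have : (2 : Fin 3) ∈ ({0, 1} : Set (Fin 3)) := h ▸ Set.mem_univ _
      simp at this
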